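/- **Conventions.** For a complete separable metric space $(X,d)$, let $\mathscr W_2(X)$ be the set of Borel probability measures $\mu$ on $X$ with $\int d(x_0,x)^2\,\mu(dx)<\infty$ for some $x_0\in X$, with the metric $$\mathrm W_2(\mu,\nu)=\Big(\inf_\Pi\int_{X\times X} d(x,y)^2\,\Pi(dx\,dy)\Big)^{1/2},$$ the infimum being over all measures $\Pi$ on $X\times X$ with first marginal $\mu$ and second marginal $\nu$. For a metric space $Y$ and $f:[0,\infty)\to[0,\infty)$ put $$\Lambda_f(Y)=\lim_{\delta\to0}\ \inf\Big\{\sum_{i} f(\operatorname{diam}E_i)\ :\ Y=\bigcup_{i\in\mathbb N} E_i,\ E_i\text{ closed},\ \operatorname{diam}E_i\le\delta\Big\}.$$ The power-exponential scale $\mathscr P$ is the family $f_s(r)=e^{-(1/r)^s}$, $f_s(0)=0$, $s\in(0,\infty)$, and the power-exponential critical parameter of $Y$ is $$\operatorname{crit}_{\mathscr P}Y=\sup\{s>0:\Lambda_{f_s}(Y)=+\infty\}\in[0,\infty],\qquad \sup\emptyset=0.$$ The upper Minkowski dimension of a compact metric space $X$ is $\inf\{s>0:\limsup_{\varepsilon\to0}N(X,\varepsilon)\,\varepsilon^s<\infty\}$,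 where $N(X,\varepsilon)$ is the least number of balls of radius $\varepsilon$ needed to cover $X$. Let $I=[0,1]$ and let $I^d\subset\mathbb R^d$ carry the Euclidean metric. **Theorem.** Let $d\ge 0$ be an integer and let $X$ be a compact metric space. Assume one of the following. 1. $X$ has upper Minkowski dimension $d$ and admits a bi-Lipschitz embedding of $I^d$. 2. $X$ is a non-empty compact $d$-dimensional Riemannian manifold. That is, $X$ is a $C^1$ manifold, possibly with boundary or corners (more generally, modelled on a convex subset with non-empty interior of a $d$-dimensional real vector space), with a continuous Riemannian metric, and the distance of $X$ is the geodesic distance or, more generally, every point of $X$ has a neighbourhood on which the distance of $X$ and the geodesic distance (infimum of lengths of $C^1$ paths) are bounded by constant multiples of each other. In particular $X$ need not be connected. Then the power-exponential critical parameter of $\mathscr W_2(X)$ is $d$ (for $d\ge1$: $\mathscr W_2(X)$ has power-exponential size): $$\operatorname{crit}_{\mathscr P}\mathscr W_2(X)=d.$$ -/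

import Mathlib

open MeasureTheory ProbabilityTheory Filter Set
open scoped ENNReal NNReal Topology

universe u v w

noncomputable section

/-! ### The quadratic Wasserstein space -/

set_option linter.unusedSectionVars false

section Transport

variable {X : Type*} [MetricSpace X] [MeasurableSpace X]

/-- The set of transport plans (couplings) between two measures. -/
def transportPlans (μ ν : Measure X) : Set (Measure (X × X)) :=
  {π | π.map Prod.fst = μ ∧ π.map Prod.snd = ν}

/-- The total quadratic cost of a transport plan. -/
def quadraticCost (π : Measure (X × X)) : ℝ≥0∞ :=
  ∫⁻ z, edist z.1 z.2 ^ 2 ∂π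

/-- The quadratic Wasserstein distance `(inf_π ∫ d(x,y)² dπ) ^ (1/2)`, with values in `[0, ∞]`. -/
def wassersteinEDist (μ ν : Measure X) : ℝ≥0∞ :=
  (⨅ π ∈ transportPlans μ ν, quadraticCost π) ^ (1 / 2 : ℝ)

lemma quadraticCost_swap [OpensMeasurableSpace X] [SecondCountableTopology X]
    (π : Measure (X × X)) : quadraticCost (π.map Prod.swap) = quadraticCost π := by
  unfold quadraticCost
  rw [lintegral_map (by fun_prop) measurable_swap]
  simp [edist_comm]

lemma transportPlans_swap {μ ν : Measure X} {π : Measure (X × X)}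
    (h : π ∈ transportPlans μ ν) : π.map Prod.swap ∈ transportPlans ν μ := by
  constructor
  · rw [Measure.map_map measurable_fst measurable_swap]; exact h.2
  · rw [Measure.map_map measurable_snd measurable_swap]; exact h.1

lemma wassersteinEDist_comm_le [OpensMeasurableSpace X] [SecondCountableTopology X]
    (μ ν : Measure X) : wassersteinEDist μ ν ≤ wassersteinEDist ν μ := by
  refine ENNReal.rpow_le_rpow (le_iInf₂ fun π hπ => ?_) (by norm_num)
  rw [← quadraticCost_swap]
  exact iInf₂_le _ (transportPlans_swap hπ)

lemma wassersteinEDist_le_of_mem {μ ν : Measure X} {π : Measure (X × X)}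
    (h : π ∈ transportPlans μ ν) : wassersteinEDist μ ν ≤ quadraticCost π ^ (1 / 2 : ℝ) :=
  ENNReal.rpow_le_rpow (iInf₂_le _ h) (by norm_num)

lemma wassersteinEDist_eq_iInf (μ ν : Measure X) :
    wassersteinEDist μ ν = ⨅ π ∈ transportPlans μ ν, quadraticCost π ^ (1 / 2 : ℝ) := by
  have := (ENNReal.orderIsoRpow (1 / 2 : ℝ) (by norm_num)).map_iInf₂
    (fun π (_ : π ∈ transportPlans μ ν) => quadraticCost π)
  simpa only [ENNReal.orderIsoRpow_apply, wassersteinEDist] using this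

lemma wassersteinEDist_self [OpensMeasurableSpace X] [SecondCountableTopology X] (μ : Measure X) :
    wassersteinEDist μ μ = 0 := by
  have hd : Measurable fun x : X => (x, x) := by fun_prop
  have h : μ.map (fun x => (x, x)) ∈ transportPlans μ μ := by
    constructor
    · rw [Measure.map_map measurable_fst hd]; exact Measure.map_id
    · rw [Measure.map_map measurable_snd hd]; exact Measure.map_id
  have h' := wassersteinEDist_le_of_mem h
  have h0 : quadraticCost (μ.map fun x => (x, x)) = 0 := by
    unfold quadraticCost
    rw [lintegral_map (by fun_prop) hd]
    simp
  rw [h0, ENNReal.zero_rpow_of_pos (by norm_num)] at h'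
  exact le_antisymm h' zero_le

lemma isProbabilityMeasure_of_mem_transportPlans {μ ν : Measure X} [IsProbabilityMeasure μ]
    {π : Measure (X × X)} (h : π ∈ transportPlans μ ν) : IsProbabilityMeasure π := by
  constructor
  have := h.1 ▸ (measure_univ : μ univ = 1)
  rwa [Measure.map_apply measurable_fst MeasurableSet.univ, preimage_univ] at this

lemma exists_glued_plan [BorelSpace X] [PolishSpace X] {μ ν ξ : Measure X}
    [IsProbabilityMeasure μ] [IsProbabilityMeasure ν] {π₁ π₂ : Measure (X × X)}
    (h₁ : π₁ ∈ transportPlans μ ν) (h₂ : π₂ ∈ transportPlans ν ξ) :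
    ∃ ρ : Measure ((X × X) × X), ρ.map Prod.fst = π₁ ∧ ρ.map (fun w => (w.1.2, w.2)) = π₂ := by
  have := isProbabilityMeasure_of_mem_transportPlans h₁
  have := isProbabilityMeasure_of_mem_transportPlans h₂
  have : Nonempty X := nonempty_of_isProbabilityMeasure μ
  refine ⟨π₁ ⊗ₘ (π₂.condKernel.comap Prod.snd measurable_snd), Measure.fst_compProd _ _, ?_⟩
  have key : π₂ = π₂.fst ⊗ₘ π₂.condKernel := (π₂.disintegrate _).symm
  conv_rhs => rw [key]
  have hm : Measurable fun w : (X × X) × X => (w.1.2, w.2) := by fun_prop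
  refine Measure.ext_of_lintegral _ fun f hf => ?_
  rw [lintegral_map hf hm, Measure.lintegral_compProd (by fun_prop),
    Measure.lintegral_compProd hf]
  have hfst : π₂.fst = π₁.map Prod.snd := h₂.1.trans h₁.2.symm
  rw [hfst, lintegral_map (Measurable.lintegral_kernel_prod_right' hf) measurable_snd]
  simp [Kernel.comap_apply]

lemma wassersteinEDist_triangle [BorelSpace X] [PolishSpace X] (μ ν ξ : Measure X)
    [IsProbabilityMeasure μ] [IsProbabilityMeasure ν] :
    wassersteinEDist μ ξ ≤ wassersteinEDist μ ν + wassersteinEDist ν ξ := by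
  rw [wassersteinEDist_eq_iInf μ ν, wassersteinEDist_eq_iInf ν ξ]
  simp only [ENNReal.iInf_add, ENNReal.add_iInf]
  refine le_iInf₂ fun π₂ h₂ => le_iInf₂ fun π₁ h₁ => ?_
  obtain ⟨ρ, hρ₁, hρ₂⟩ := exists_glued_plan h₁ h₂
  have m₁ : Measurable fun w : (X × X) × X => (w.1.2, w.2) := by fun_prop
  have m₂ : Measurable fun w : (X × X) × X => (w.1.1, w.2) := by fun_prop
  have hρ : ρ.map (fun w => (w.1.1, w.2)) ∈ transportPlans μ ξ := by
    constructor
    · rw [Measure.map_map measurable_fst m₂, ← h₁.1, ← hρ₁,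
        Measure.map_map measurable_fst measurable_fst]
      rfl
    · rw [Measure.map_map measurable_snd m₂, ← h₂.2, ← hρ₂,
        Measure.map_map measurable_snd m₁]
      rfl
  refine (wassersteinEDist_le_of_mem hρ).trans ?_
  have e₁ : quadraticCost π₁ = ∫⁻ w, edist w.1.1 w.1.2 ^ (2 : ℝ) ∂ρ := by
    rw [← hρ₁, quadraticCost, lintegral_map (by fun_prop) measurable_fst]
    simp
  have e₂ : quadraticCost π₂ = ∫⁻ w, edist w.1.2 w.2 ^ (2 : ℝ) ∂ρ := by
    rw [← hρ₂, quadraticCost, lintegral_map (by fun_prop) m₁]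
    simp
  have e₃ : quadraticCost (ρ.map fun w => (w.1.1, w.2)) =
      ∫⁻ w, edist w.1.1 w.2 ^ (2 : ℝ) ∂ρ := by
    rw [quadraticCost, lintegral_map (by fun_prop) m₂]
    simp
  rw [e₁, e₂, e₃]
  refine le_trans ?_ (ENNReal.lintegral_Lp_add_le (p := 2) (μ := ρ)
    (f := fun w => edist w.1.1 w.1.2) (g := fun w => edist w.1.2 w.2)
    (by fun_prop) (by fun_prop) (by norm_num))
  refine ENNReal.rpow_le_rpow (lintegral_mono fun w => ?_) (by norm_num)
  exact ENNReal.rpow_le_rpow (edist_triangle _ _ _) (by norm_num)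

lemma wassersteinEDist_dirac_right [OpensMeasurableSpace X] [SecondCountableTopology X]
    (μ : Measure X) [IsProbabilityMeasure μ] (x₀ : X) :
    wassersteinEDist μ (Measure.dirac x₀) ≤ (∫⁻ x, edist x₀ x ^ 2 ∂μ) ^ (1 / 2 : ℝ) := by
  have hm : Measurable fun x : X => (x, x₀) := by fun_prop
  have h : μ.map (fun x => (x, x₀)) ∈ transportPlans μ (Measure.dirac x₀) := by
    constructor
    · rw [Measure.map_map measurable_fst hm]; exact Measure.map_id
    · rw [Measure.map_map measurable_snd hm]
      change μ.map (fun _ => x₀) = _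
      simp
  refine (wassersteinEDist_le_of_mem h).trans_eq ?_
  rw [quadraticCost, lintegral_map (by fun_prop) hm]
  simp [edist_comm]

lemma measure_le_thickening_of_wassersteinEDist_eq_zero [OpensMeasurableSpace X]
    [SecondCountableTopology X] {μ ν : Measure X} (h : wassersteinEDist μ ν = 0) (F : Set X)
    (hF : IsClosed F) {δ : ℝ} (hδ : 0 < δ) : μ F ≤ ν (Metric.thickening δ F) := by
  have h0 : (⨅ π ∈ transportPlans μ ν, quadraticCost π) = 0 := by
    rcases ENNReal.rpow_eq_zero_iff.1 h with h | h
    · exact h.1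
    · norm_num at h
  refine ENNReal.le_of_forall_pos_le_add fun ε hε _ => ?_
  have hδ2 : ENNReal.ofReal δ ^ 2 ≠ 0 := by simpa using hδ
  have hδt : ENNReal.ofReal δ ^ 2 ≠ ∞ := by simp
  have hlt : (⨅ π ∈ transportPlans μ ν, quadraticCost π) < ε * ENNReal.ofReal δ ^ 2 := by
    rw [h0]
    exact ENNReal.mul_pos (by simpa using hε.ne') hδ2
  obtain ⟨π, hπ, hc⟩ := by simpa only [iInf_lt_iff] using hlt
  have hmarkov := mul_meas_ge_le_lintegral (μ := π) (f := fun z => edist z.1 z.2 ^ 2)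
    (by fun_prop) (ENNReal.ofReal δ ^ 2)
  have hbad : π {z | ENNReal.ofReal δ ^ 2 ≤ edist z.1 z.2 ^ 2} ≤ ε := by
    rw [mul_comm] at hc
    exact (ENNReal.mul_le_mul_iff_right hδ2 hδt).1 (hmarkov.trans hc.le)
  rw [← hπ.1, Measure.map_apply measurable_fst hF.measurableSet, ← hπ.2,
    Measure.map_apply measurable_snd Metric.isOpen_thickening.measurableSet]
  refine (measure_mono ?_).trans ((measure_union_le _ _).trans (add_le_add le_rfl hbad))
  rintro ⟨x, y⟩ (hx : x ∈ F)
  by_cases hxy : edist x y < ENNReal.ofReal δ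
  · left
    rw [mem_preimage, Metric.mem_thickening_iff_infEDist_lt]
    exact (Metric.infEDist_le_edist_of_mem hx).trans_lt (by rwa [edist_comm])
  · right
    exact pow_le_pow_left₀ zero_le (not_lt.1 hxy) 2

lemma eq_of_wassersteinEDist_eq_zero [BorelSpace X] [SecondCountableTopology X]
    {μ ν : Measure X} [IsProbabilityMeasure μ] [IsProbabilityMeasure ν]
    (h : wassersteinEDist μ ν = 0) : μ = ν := by
  have key : ∀ {μ ν : Measure X} [IsProbabilityMeasure μ] [IsProbabilityMeasure ν],
      wassersteinEDist μ ν = 0 → ∀ F, IsClosed F → μ F ≤ ν F := by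
    intro μ ν _ _ h F hF
    refine ge_of_tendsto (tendsto_measure_thickening_of_isClosed (μ := ν)
      ⟨1, one_pos, measure_ne_top _ _⟩ hF) ?_
    filter_upwards [self_mem_nhdsWithin] with δ hδ
    exact measure_le_thickening_of_wassersteinEDist_eq_zero h F hF hδ
  have h' : wassersteinEDist ν μ = 0 :=
    le_antisymm ((wassersteinEDist_comm_le _ _).trans_eq h) zero_le
  refine ext_of_generate_finite _ ?_ isPiSystem_isClosed
    (fun F hF => le_antisymm (key h F hF) (key h' F hF)) (by simp)
  rw [BorelSpace.measurable_eq (α := X), borel_eq_generateFrom_isClosed]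

end Transport

/-- The Wasserstein space `𝒲₂(X)`: Borel probability measures with finite second moment. -/
def WassersteinSpace (X : Type*) [MetricSpace X] [MeasurableSpace X] : Type _ :=
  {μ : Measure X // IsProbabilityMeasure μ ∧ ∃ x₀ : X, ∫⁻ x, edist x₀ x ^ 2 ∂μ < ∞}

namespace WassersteinSpace

variable {X : Type*} [MetricSpace X] [MeasurableSpace X]

instance (μ : WassersteinSpace X) : IsProbabilityMeasure μ.1 := μ.2.1

lemma wassersteinEDist_ne_top [BorelSpace X] [PolishSpace X] (μ ν : WassersteinSpace X) :
    wassersteinEDist μ.1 ν.1 ≠ ∞ := by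
  have aux : ∀ (ξ : Measure X) [IsProbabilityMeasure ξ] (x : X),
      ∫⁻ y, edist x y ^ 2 ∂ξ < ∞ → wassersteinEDist ξ (Measure.dirac x) < ∞ := fun ξ _ x hx =>
    (wassersteinEDist_dirac_right ξ x).trans_lt
      (ENNReal.rpow_lt_top_of_nonneg (by norm_num) hx.ne)
  obtain ⟨x, hx⟩ := μ.2.2
  obtain ⟨y, hy⟩ := ν.2.2
  have h₁ := aux μ.1 x hx
  have h₂ := aux (Measure.dirac x) y (by
    rw [lintegral_dirac' _ (by fun_prop)]
    exact ENNReal.pow_lt_top (edist_lt_top _ _))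
  have h₃ := (wassersteinEDist_comm_le _ _).trans_lt (aux ν.1 y hy)
  refine ne_of_lt ((wassersteinEDist_triangle μ.1 (Measure.dirac x) ν.1).trans_lt ?_)
  refine ENNReal.add_lt_top.2 ⟨h₁, ?_⟩
  exact (wassersteinEDist_triangle _ (Measure.dirac y) ν.1).trans_lt
    (ENNReal.add_lt_top.2 ⟨h₂, h₃⟩)

/-- The Wasserstein metric `W₂`. -/
instance instMetricSpace [BorelSpace X] [PolishSpace X] : MetricSpace (WassersteinSpace X) :=
  @EMetricSpace.toMetricSpace (WassersteinSpace X)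
    { edist := fun μ ν => wassersteinEDist μ.1 ν.1
      edist_self := fun μ => wassersteinEDist_self μ.1
      edist_comm := fun μ ν =>
        le_antisymm (wassersteinEDist_comm_le μ.1 ν.1) (wassersteinEDist_comm_le ν.1 μ.1)
      edist_triangle := fun μ ν ξ => wassersteinEDist_triangle μ.1 ν.1 ξ.1
      eq_of_edist_eq_zero := fun h => Subtype.ext (eq_of_wassersteinEDist_eq_zero h) }
    wassersteinEDist_ne_top

lemma edist_def [BorelSpace X] [PolishSpace X] (μ ν : WassersteinSpace X) :
    edist μ ν = wassersteinEDist μ.1 ν.1 := rfl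

end WassersteinSpace

/-! ### Carathéodory's construction and critical parameters -/

/-- Carathéodory's construction: the limit (equivalently the supremum) as `δ → 0` of the infimum of
`∑ f (diam Eᵢ)` over coverings of `A` by a sequence of closed sets of diameter at most `δ`. -/
def caratheodoryMeasure {X : Type*} [MetricSpace X] (f : ℝ → ℝ) (A : Set X) : ℝ≥0∞ :=
  ⨆ (δ : ℝ) (_ : 0 < δ),
    ⨅ (E : ℕ → Set X) (_ : A ⊆ ⋃ i, E i)
      (_ : ∀ i, IsClosed (E i) ∧ Metric.ediam (E i) ≤ ENNReal.ofReal δ),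
      ∑' i, ENNReal.ofReal (f (Metric.diam (E i)))

/-- The critical parameter of `A` with respect to a scale `(f s)` whose parameter `s` runs over
`(0, ∞)`. It lies in the closure `[0, ∞]` of the parameter set, so the supremum of the empty set
is `0`. -/
def critParam {X : Type*} [MetricSpace X] (f : ℝ → ℝ → ℝ) (A : Set X) : ℝ≥0∞ :=
  ⨆ (s : ℝ) (_ : 0 < s) (_ : caratheodoryMeasure (f s) A = ∞), ENNReal.ofReal s

/-- The power-exponential scale `r ↦ exp (-(1 / r) ^ s)`, extended by `0` at `r = 0`. -/
def powerExpScale (s r : ℝ) : ℝ :=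
  if r = 0 then 0 else Real.exp (-(1 / r) ^ s)

end

open scoped Bundle

noncomputable section

/-! ### Hypotheses on the base space -/

/-- The upper Minkowski dimension `inf {s > 0 | limsup_{ε → 0} N(X, ε) ε ^ s < ∞}`, where `N(X, ε)`
is the minimal number of balls of radius `ε` needed to cover `X`. -/
def upperMinkowskiDim (X : Type*) [MetricSpace X] : ℝ≥0∞ :=
  ⨅ (s : ℝ) (_ : 0 < s)
    (_ : limsup (fun ε : ℝ≥0 =>
      ((Metric.coveringNumber ε (univ : Set X) : ℕ∞) : ℝ≥0∞) * (ε : ℝ≥0∞) ^ s) (𝓝[>] 0) < ∞),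
    ENNReal.ofReal s

/-- The cube `I ^ d`, as a subset of Euclidean space. -/
def euclideanCube (d : ℕ) : Set (EuclideanSpace ℝ (Fin d)) :=
  {x | ∀ i, x i ∈ Icc (0 : ℝ) 1}

/-- `X` contains a bi-Lipschitz image of the cube `I ^ d`. -/
def AdmitsBiLipschitzCube (X : Type*) [MetricSpace X] (d : ℕ) : Prop :=
  ∃ (g : euclideanCube d → X) (K L : ℝ≥0), LipschitzWith K g ∧ AntilipschitzWith L g

/-- The metric of `X` is, near every point, bi-Lipschitz equivalent to the geodesic distance of a
given Riemannian metric. This holds (with equality) for the geodesic distance itself. -/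
def IsLocallyRiemannian {E : Type*} [NormedAddCommGroup E] [NormedSpace ℝ E]
    {H : Type*} [TopologicalSpace H] (I : ModelWithCorners ℝ E H)
    (X : Type*) [MetricSpace X] [ChartedSpace H X]
    [Bundle.RiemannianBundle (fun x : X => TangentSpace I x)] : Prop :=
  ∀ x : X, ∃ U ∈ 𝓝 x, ∃ C : ℝ≥0, ∀ y ∈ U, ∀ z ∈ U,
    edist y z ≤ C * Manifold.riemannianEDist I y z ∧
      Manifold.riemannianEDist I y z ≤ C * edist y z

end

/-! The critical parameter is squeezed between a covering count and a random construction; both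
kinds of base space supply the same two inputs, a covering exponent above and a bi-Lipschitz cube
below.

Upper bound. Cut `X` into `n` cells of diameter at most `ε`, with `n` of order `ε ^ (-s₁)`. A
measure is determined up to a distance of order `ε` by its cell masses rounded to multiples of `1 /
M`, with `M` of order `n / ε ^ 2`: matching masses move inside their cells, the small excess moves
anywhere (`exists_transportPlan_of_partition`). So `(M + 1) ^ n` sets cover the Wasserstein space.
The logarithm of this number is `O(ε ^ (-s₁) * log (1 / ε))`, which is beaten by `(1 / (2 * ε)) ^ s`
for every `s > s₁`.

Lower bound. Put at each level `k` a family of `G ^ k` pairs of well separated points in the cube,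
choose one point in each pair by independent fair coins, and give total mass `2 ^ (-(k + 1))` to the
chosen points of level `k`. Two outcomes that disagree on a fixed proportion of the coins of level
`k` are at Wasserstein distance at least of order `β ^ k`. A smaller set therefore only contains
outcomes from one Hamming ball, of probability at most `(5 / 6) ^ G ^ k` (`choiceLaw_preimage_le`).
The same law serves all levels, so the mass distribution principle makes Carathéodory's construction
infinite whenever `β ^ (-s) < G`. The geometric mass weights and the separation of levels cost fixed
powers of two in `β` and `G`; a finer grid, that is a large parameter `m`, makes these losses
negligible, and every `s` below the dimension is reached.

For a manifold, charts are locally bi-Lipschitz for the Riemannian distance, by comparing lengths of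
paths on both sides, and both inputs are read off in Euclidean space. -/

section RiemannianChart

/-! ### Charts are locally bi-Lipschitz for the Riemannian distance. -/

open Manifold Metric

variable {E : Type*} [NormedAddCommGroup E] [NormedSpace ℝ E]
  {H : Type*} [TopologicalSpace H] (I : ModelWithCorners ℝ E H)
  {M : Type*} [TopologicalSpace M] [ChartedSpace H M]
  [Bundle.RiemannianBundle (fun x : M => TangentSpace I x)]
  [IsManifold I 1 M]

attribute [local instance] normedAddCommGroupTangentSpaceVectorSpace
attribute [local instance] normedSpaceTangentSpaceVectorSpace

/-- A path staying in a region where the derivative of the extended chart is bounded by `C` has an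
image in the chart whose endpoints are at distance at most `C` times its length. -/
lemma edist_extChartAt_le_mul_pathELength {x : M} {C : ℝ≥0} {u : Set M}
    (hu : ∀ y ∈ u, ∀ v : TangentSpace I y, ‖mfderiv% (extChartAt I x) y v‖ₑ ≤ C * ‖v‖ₑ)
    (uc : u ⊆ (chartAt H x).source)
    {γ : ℝ → M} (hγ : CMDiff[Icc 0 1] 1 γ) (hγu : ∀ t ∈ Icc (0 : ℝ) 1, γ t ∈ u) :
    edist (extChartAt I x (γ 0)) (extChartAt I x (γ 1)) ≤ C * pathELength I γ 0 1 := by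
  let γ' := extChartAt I x ∘ γ
  have hC : CMDiff[Icc 0 1] 1 γ' :=
    contMDiffOn_extChartAt.comp (I' := I) (t := (chartAt H x).source)
      hγ (fun t' ht' ↦ uc <| hγu t' ht')
  calc
    edist (extChartAt I x (γ 0)) (extChartAt I x (γ 1)) = ‖γ' 1 - γ' 0‖ₑ := by
      rw [edist_comm, edist_eq_enorm_sub]; rfl
    _ ≤ ∫⁻ t' in Icc 0 1, ‖derivWithin γ' (Icc 0 1) t'‖ₑ := by
      apply enorm_sub_le_lintegral_derivWithin_Icc_of_contDiffOn_Icc _ zero_le_one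
      rwa [← contMDiffOn_iff_contDiffOn]
    _ = ∫⁻ t' in Icc 0 1, ‖mfderiv[Icc 0 1] γ' t' 1‖ₑ := by
      simp_rw [← fderivWithin_derivWithin, mfderivWithin_eq_fderivWithin]
      rfl
    _ ≤ ∫⁻ t' in Icc 0 1, C * ‖mfderiv[Icc 0 1] γ t' 1‖ₑ := by
      apply setLIntegral_mono' measurableSet_Icc (fun t' ht' ↦ ?_)
      have : mfderiv[Icc 0 1] γ' t' =
          (mfderiv% (extChartAt I x) (γ t')) ∘L (mfderiv[Icc 0 1] γ t') := by
        apply mfderiv_comp_mfderivWithin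
        · exact mdifferentiableAt_extChartAt (uc (hγu t' ht'))
        · exact hγ.mdifferentiableOn one_ne_zero _ ht'
        · rw [uniqueMDiffWithinAt_iff_uniqueDiffWithinAt]
          exact uniqueDiffOn_Icc zero_lt_one _ ht'
      have : mfderiv[Icc 0 1] γ' t' 1 =
          (mfderiv% (extChartAt I x) (γ t')) (mfderiv[Icc 0 1] γ t' 1) :=
        congr($this 1)
      rw [this]
      exact hu _ (hγu t' ht') _
    _ = C * pathELength I γ 0 1 := by
      rw [lintegral_const_mul' _ _ ENNReal.coe_ne_top,
          pathELength_eq_lintegral_mfderivWithin_Icc]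

variable [IsContinuousRiemannianBundle E (fun x : M => TangentSpace I x)]

/-- Pointwise form of an operator norm bound, ready to be integrated along a path. -/
lemma eventually_enorm_mfderiv_extChartAt_apply_le (x : M) :
    ∃ C : ℝ≥0, 0 < C ∧ ∀ᶠ y in 𝓝 x, ∀ v : TangentSpace I y,
      ‖mfderiv% (extChartAt I x) y v‖ₑ ≤ C * ‖v‖ₑ := by
  rcases eventually_enorm_mfderiv_extChartAt_lt I x with ⟨C, C_pos, hC⟩
  refine ⟨C, C_pos, ?_⟩
  filter_upwards [hC] with y hy v
  refine le_trans ?_ (mul_le_mul_left hy.le _)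
  with_unfolding_all exact ContinuousLinearMap.le_opENorm _ _

lemma eventually_enorm_mfderivWithin_symm_extChartAt_apply_le (x : M) :
    ∃ C : ℝ≥0, 0 < C ∧ ∀ᶠ y in 𝓝[range I] (extChartAt I x x), ∀ v : TangentSpace 𝓘(ℝ, E) y,
      ‖mfderiv[range I] (extChartAt I x).symm y v‖ₑ ≤ C * ‖v‖ₑ := by
  rcases eventually_enorm_mfderivWithin_symm_extChartAt_lt I x with ⟨C, C_pos, hC⟩
  refine ⟨C, C_pos, ?_⟩
  filter_upwards [hC] with y hy v
  refine le_trans ?_ (mul_le_mul_left hy.le _)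
  with_unfolding_all exact ContinuousLinearMap.le_opENorm _ _

/-- The inverse of the extended chart is locally Lipschitz for the Riemannian distance. -/
lemma exists_nhds_riemannianEDist_le_edist_extChartAt (x : M) :
    ∃ C : ℝ≥0, ∃ V ∈ 𝓝 x, ∀ y ∈ V, ∀ z ∈ V,
      riemannianEDist I y z ≤ C * edist (extChartAt I x y) (extChartAt I x z) := by
  rcases eventually_enorm_mfderivWithin_symm_extChartAt_apply_le I x with ⟨C, C_pos, hC⟩
  obtain ⟨r, r_pos, hr⟩ : ∃ r > 0,
      ball (extChartAt I x x) r ∩ range I ⊆ (extChartAt I x).target ∩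
        {y | ∀ v : TangentSpace 𝓘(ℝ, E) y,
          ‖mfderiv[range I] (extChartAt I x).symm y v‖ₑ ≤ C * ‖v‖ₑ} :=
    mem_nhdsWithin_iff.1 (inter_mem (extChartAt_target_mem_nhdsWithin x) hC)
  have A : (extChartAt I x) ⁻¹' (ball (extChartAt I x x) r ∩ range I) ∈ 𝓝 x := by
    apply extChartAt_preimage_mem_nhds_of_mem_nhdsWithin (by simp)
    rw [inter_comm]
    exact inter_mem_nhdsWithin _ (ball_mem_nhds _ r_pos)
  refine ⟨C, _, inter_mem A (chart_source_mem_nhds H x), ?_⟩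
  rintro y ⟨hy, h'y⟩ z ⟨hz, h'z⟩
  -- The test path is the pullback of the straight segment between the chart images. The segment
  -- stays in the region of bounded derivative since a ball intersected with `range I` is convex.
  let η := ContinuousAffineMap.lineMap (R := ℝ) (extChartAt I x y) (extChartAt I x z)
  set γ := (extChartAt I x).symm ∘ η
  have hη : Icc 0 1 ⊆ ⇑η ⁻¹' ((extChartAt I x).target ∩
        {y | ∀ v : TangentSpace 𝓘(ℝ, E) y,
          ‖mfderiv[range I] (extChartAt I x).symm y v‖ₑ ≤ C * ‖v‖ₑ}) := by
    simp only [← image_subset_iff, ContinuousAffineMap.coe_lineMap_eq,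
     ← segment_eq_image_lineMap, η]
    apply Subset.trans _ hr
    exact ((convex_ball _ _).inter I.convex_range).segment_subset hy hz
  simp only [preimage_inter, subset_inter_iff] at hη
  have η_smooth : CMDiff[Icc 0 1] 1 η := by
    apply ContMDiff.contMDiffOn
    rw [contMDiff_iff_contDiff]
    exact ContinuousAffineMap.contDiff _
  have : riemannianEDist I y z ≤ pathELength I γ 0 1 := by
    apply riemannianEDist_le_pathELength _ _ _ zero_le_one
    · exact (contMDiffOn_extChartAt_symm x).comp η_smooth hη.1
    · simp [γ, η, ContinuousAffineMap.coe_lineMap_eq, h'y]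
    · simp [γ, η, ContinuousAffineMap.coe_lineMap_eq, h'z]
  apply this.trans
  rw [← lintegral_fderiv_lineMap_eq_edist, pathELength_eq_lintegral_mfderivWithin_Icc,
    ← lintegral_const_mul' _ _ ENNReal.coe_ne_top]
  apply setLIntegral_mono' measurableSet_Icc (fun t ht ↦ ?_)
  have : mfderiv[Icc 0 1] γ t =
      (mfderiv[range I] (extChartAt I x).symm (η t)) ∘L (mfderiv[Icc 0 1] η t) := by
    apply mfderivWithin_comp
    · exact mdifferentiableWithinAt_extChartAt_symm (hη.1 ht)
    · exact η_smooth.mdifferentiableOn one_ne_zero t ht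
    · exact hη.1.trans (preimage_mono (extChartAt_target_subset_range x))
    · rw [uniqueMDiffWithinAt_iff_uniqueDiffWithinAt]
      exact uniqueDiffOn_Icc zero_lt_one t ht
  have : mfderiv[Icc 0 1] γ t 1 =
      (mfderiv[range I] (extChartAt I x).symm (η t)) (mfderiv[Icc 0 1] η t 1) := congr($this 1)
  rw [this]
  refine (hη.2 ht _).trans ?_
  gcongr
  · simp only [mfderivWithin_eq_fderivWithin]
    exact le_of_eq rfl

/-- The extended chart is locally Lipschitz for the Riemannian distance. -/
lemma exists_nhds_edist_extChartAt_le_riemannianEDist [RegularSpace M] (x : M) :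
    ∃ C : ℝ≥0, ∃ V ∈ 𝓝 x, ∀ y ∈ V, ∀ z ∈ V,
      edist (extChartAt I x y) (extChartAt I x z) ≤ C * riemannianEDist I y z := by
  rcases eventually_enorm_mfderiv_extChartAt_apply_le I x with ⟨C, C_pos, hC⟩
  -- The good region contains the Riemannian ball of radius `c` about `x`. Two points at distance
  -- less than `c / 4` from `x` are joined by a nearly shortest path of length less than `c / 2`,
  -- which stays within `3 * c / 4` of `x`.
  obtain ⟨c, c_pos, hc⟩ := setOfPred_riemannianEDist_lt_subset_nhds I
    (inter_mem hC (chart_source_mem_nhds H x))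
  have c4 : (0 : ℝ≥0∞) < ↑(c / 4) := by
    rw [ENNReal.coe_pos]; positivity
  refine ⟨C, _, eventually_riemannianEDist_lt I x c4, fun y hy z hz => ?_⟩
  have hyz : riemannianEDist I y z < ↑(c / 2) := by
    refine riemannianEDist_triangle (y := x) |>.trans_lt ?_
    rw [riemannianEDist_comm]
    refine (ENNReal.add_lt_add hy hz).trans_eq ?_
    rw [← ENNReal.coe_add]; congr 1
    ext; push_cast; ring
  have key : ∀ r, riemannianEDist I y z < r →
      edist (extChartAt I x y) (extChartAt I x z) ≤ C * r := by
    intro r hr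
    obtain ⟨γ, h0, h1, hγ, hlen⟩ := exists_lt_of_riemannianEDist_lt (lt_min hr hyz)
    rw [← h0, ← h1]
    refine (edist_extChartAt_le_mul_pathELength I (fun y hy => hy.1) (fun y hy => hy.2) hγ
      fun t ht => hc ?_).trans (mul_le_mul_right (hlen.le.trans (min_le_left _ _)) _)
    have : riemannianEDist I y (γ t) < ↑(c / 2) :=
      (riemannianEDist_le_pathELength (hγ.mono (Icc_subset_Icc le_rfl ht.2)) h0 rfl ht.1).trans_lt
        ((pathELength_mono le_rfl ht.2).trans_lt (hlen.trans_le (min_le_right _ _)))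
    refine (riemannianEDist_triangle (y := y)).trans_lt ((ENNReal.add_lt_add hy this).trans_le ?_)
    rw [← ENNReal.coe_add, ENNReal.coe_le_coe, ← NNReal.coe_le_coe]
    push_cast
    linarith [c.2, show (0 : ℝ) < c from c_pos]
  by_cases h0 : C = 0
  · exact absurd h0 C_pos.ne'
  rw [mul_comm, ← ENNReal.div_le_iff_le_mul (by simp [h0]) (by simp)]
  refine le_of_forall_gt fun r hr => ?_
  obtain ⟨r', hr', hrr'⟩ := exists_between hr
  refine lt_of_le_of_lt ?_ hrr'
  rw [ENNReal.div_le_iff_le_mul (by simp [h0]) (by simp), mul_comm]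
  exact key r' hr'

end RiemannianChart

lemma IsLocallyRiemannian.exists_bilipschitz_extChartAt
    {E : Type*} [NormedAddCommGroup E] [NormedSpace ℝ E]
    {H : Type*} [TopologicalSpace H] {I : ModelWithCorners ℝ E H}
    {X : Type*} [MetricSpace X] [ChartedSpace H X]
    [Bundle.RiemannianBundle (fun x : X => TangentSpace I x)] [IsManifold I 1 X]
    [IsContinuousRiemannianBundle E (fun x : X => TangentSpace I x)]
    (h : IsLocallyRiemannian I X) (x : X) :
    ∃ C : ℝ≥0, ∃ V ∈ 𝓝 x, ∀ y ∈ V, ∀ z ∈ V,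
      edist y z ≤ C * edist (extChartAt I x y) (extChartAt I x z) ∧
      edist (extChartAt I x y) (extChartAt I x z) ≤ C * edist y z := by
  obtain ⟨U, hU, C₀, h₀⟩ := h x
  obtain ⟨C₁, V₁, hV₁, h₁⟩ := exists_nhds_riemannianEDist_le_edist_extChartAt I x
  obtain ⟨C₂, V₂, hV₂, h₂⟩ := exists_nhds_edist_extChartAt_le_riemannianEDist I x
  refine ⟨C₀ * C₁ + C₂ * C₀, _, inter_mem hU (inter_mem hV₁ hV₂), ?_⟩
  rintro y ⟨hy, hy₁, hy₂⟩ z ⟨hz, hz₁, hz₂⟩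
  constructor
  · calc edist y z ≤ C₀ * (C₁ * edist (extChartAt I x y) (extChartAt I x z)) :=
          (h₀ y hy z hz).1.trans (mul_le_mul_right (h₁ y hy₁ z hz₁) _)
      _ = ↑(C₀ * C₁) * edist (extChartAt I x y) (extChartAt I x z) := by
          rw [← mul_assoc, ENNReal.coe_mul]
      _ ≤ _ := by gcongr; simp
  · calc edist (extChartAt I x y) (extChartAt I x z) ≤ C₂ * (C₀ * edist y z) :=
          (h₂ y hy₂ z hz₂).trans (mul_le_mul_right (h₀ y hy z hz).2 _)
      _ = ↑(C₂ * C₀) * edist y z := by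
          rw [← mul_assoc, ENNReal.coe_mul]
      _ ≤ _ := by gcongr; simp

/-! ### Covering exponents. -/

/-- The set `A` can be covered by `O(ε ^ (-s))` sets of diameter at most `ε`. -/
def HasCoveringExponent {X : Type*} [MetricSpace X] (A : Set X) (s : ℝ) : Prop :=
  ∃ C : ℝ, ∀ᶠ ε in 𝓝[>] (0 : ℝ), ∃ (ι : Type) (_ : Fintype ι) (B : ι → Set X),
    A ⊆ ⋃ i, B i ∧ (∀ i, Metric.ediam (B i) ≤ ENNReal.ofReal ε) ∧
      (Fintype.card ι : ℝ) ≤ C * ε ^ (-s)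

namespace HasCoveringExponent

variable {X : Type*} [MetricSpace X] {A B : Set X} {s t : ℝ}

lemma empty : HasCoveringExponent (∅ : Set X) s :=
  ⟨0, Eventually.of_forall fun ε => ⟨Empty, inferInstance, fun _ => ∅, by simp, by simp, by simp⟩⟩

lemma mono_set (h : HasCoveringExponent B s) (hAB : A ⊆ B) : HasCoveringExponent A s := by
  obtain ⟨C, hC⟩ := h
  refine ⟨C, hC.mono ?_⟩
  rintro ε ⟨ι, _, D, h₁, h₂⟩
  exact ⟨ι, _, D, hAB.trans h₁, h₂⟩

lemma union (hA : HasCoveringExponent A s) (hB : HasCoveringExponent B s) :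
    HasCoveringExponent (A ∪ B) s := by
  obtain ⟨C, hC⟩ := hA
  obtain ⟨C', hC'⟩ := hB
  refine ⟨C + C', ?_⟩
  filter_upwards [hC, hC']
  rintro ε ⟨ι, _, D, h₁, h₂, h₃⟩ ⟨ι', _, D', h₁', h₂', h₃'⟩
  refine ⟨ι ⊕ ι', inferInstance, Sum.elim D D', ?_, ?_, ?_⟩
  · rw [iUnion_sum]
    exact union_subset_union h₁ h₁'
  · rintro (i | i)
    exacts [h₂ i, h₂' i]
  · rw [Fintype.card_sum]
    push_cast
    linarith

lemma mono_exponent (h : HasCoveringExponent A s) (hst : s ≤ t) : HasCoveringExponent A t := by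
  obtain ⟨C, hC⟩ := h
  refine ⟨|C|, ?_⟩
  filter_upwards [hC, Ioo_mem_nhdsGT one_pos]
  rintro ε ⟨ι, _, D, h₁, h₂, h₃⟩ ⟨h0, h1⟩
  refine ⟨ι, _, D, h₁, h₂, h₃.trans ?_⟩
  calc C * ε ^ (-s) ≤ |C| * ε ^ (-s) := by gcongr; exact le_abs_self C
    _ ≤ |C| * ε ^ (-t) := by
      gcongr 1
      exact Real.rpow_le_rpow_of_exponent_ge h0 h1.le (by linarith)

lemma of_forall_nhds [CompactSpace X] (h : ∀ x : X, ∃ V ∈ 𝓝 x, HasCoveringExponent V s) :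
    HasCoveringExponent (univ : Set X) s := by
  refine isCompact_univ.induction_on empty (fun _ _ hst ht => ht.mono_set hst)
    (fun _ _ hs ht => hs.union ht) fun x _ => ?_
  obtain ⟨V, hV, h⟩ := h x
  exact ⟨V, by simpa using hV, h⟩

/-- A set that embeds in a bounded subset of Euclidean space with Lipschitz inverse has covering
exponent the dimension. -/
lemma of_edist_le {d : ℕ} (f : X → EuclideanSpace ℝ (Fin d)) {c : EuclideanSpace ℝ (Fin d)}
    (hc : ∀ y ∈ A, dist (f y) c < 1) {C : ℝ≥0}
    (hf : ∀ y ∈ A, ∀ z ∈ A, edist y z ≤ C * edist (f y) (f z)) :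
    HasCoveringExponent A (d : ℝ) := by
  refine ⟨(2 * (C * d) + 5) ^ d, ?_⟩
  filter_upwards [Ioo_mem_nhdsGT one_pos]
  rintro ε ⟨h0, h1⟩
  -- Grid of mesh `1 / M` in the coordinates. A grid cell has Euclidean diameter at most `d / M`
  -- (crude, instead of `√d / M`), so its pullback has diameter at most `C * d / M ≤ ε`. Shifted
  -- coordinates lie in `(0, 2)`, whence `2 * M + 1` indices.
  set M : ℕ := ⌈C * d / ε⌉₊ + 1 with hM
  have hM0 : (0 : ℝ) < M := by rw [hM]; positivity
  have hM1 : C * d / M ≤ ε := by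
    rw [div_le_comm₀ hM0 h0, hM]
    push_cast
    linarith [Nat.le_ceil (C * d / ε)]
  have hM2 : (M : ℝ) ≤ C * d / ε + 2 := by
    rw [hM]; push_cast
    linarith [Nat.ceil_lt_add_one (show 0 ≤ C * d / ε by positivity)]
  have hcoord : ∀ y ∈ A, ∀ i, |f y i - c i| < 1 := fun y hy i => by
    rw [← Real.dist_eq]
    exact lt_of_le_of_lt (by simpa using PiLp.dist_apply_le (f y) c i) (hc y hy)
  refine ⟨Fin d → Fin (2 * M + 1), inferInstance,
    fun k => {y ∈ A | ∀ i, ⌊M * (f y i - c i + 1)⌋₊ = k i}, ?_, ?_, ?_⟩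
  · intro y hy
    have hlt : ∀ i, ⌊M * (f y i - c i + 1)⌋₊ < 2 * M + 1 := fun i => by
      have := abs_lt.1 (hcoord y hy i)
      rw [Nat.floor_lt (by nlinarith)]
      push_cast
      nlinarith
    exact mem_iUnion.2 ⟨fun i => ⟨_, hlt i⟩, hy, fun i => rfl⟩
  · intro k
    refine Metric.ediam_le fun y hy z hz => ?_
    have hyz : dist (f y) (f z) ≤ d * (1 / M) := by
      have hi : ∀ i, |f y i - f z i| ≤ 1 / M := fun i => by
        have hy1 := abs_lt.1 (hcoord y hy.1 i)
        have hz1 := abs_lt.1 (hcoord z hz.1 i)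
        have a1 := Nat.floor_le (show 0 ≤ M * (f y i - c i + 1) by nlinarith)
        have a2 := Nat.lt_floor_add_one (M * (f y i - c i + 1))
        have b1 := Nat.floor_le (show 0 ≤ M * (f z i - c i + 1) by nlinarith)
        have b2 := Nat.lt_floor_add_one (M * (f z i - c i + 1))
        rw [hy.2 i] at a1 a2
        rw [hz.2 i] at b1 b2
        rw [le_div_iff₀ hM0, ← abs_of_pos hM0, ← abs_mul, abs_le]
        constructor <;> nlinarith
      rw [EuclideanSpace.dist_eq]
      refine (Real.sqrt_le_iff).2 ⟨by positivity, ?_⟩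
      calc ∑ i, dist (f y i) (f z i) ^ 2 ≤ ∑ i : Fin d, (1 / M : ℝ) ^ 2 := by
            gcongr with i
            rw [Real.dist_eq]; exact hi i
        _ = d * (1 / M : ℝ) ^ 2 := by simp
        _ ≤ (d * (1 / M : ℝ)) ^ 2 := by
          rw [mul_pow]
          gcongr
          exact_mod_cast Nat.le_self_pow two_ne_zero d
    refine (hf y hy.1 z hz.1).trans ?_
    rw [edist_dist, ← ENNReal.ofReal_coe_nnreal, ← ENNReal.ofReal_mul (NNReal.coe_nonneg C)]
    refine ENNReal.ofReal_le_ofReal (le_trans ?_ hM1)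
    calc (C : ℝ) * dist (f y) (f z) ≤ C * (d * (1 / M)) := by gcongr
      _ = C * d / M := by ring
  · rw [Fintype.card_fun, Fintype.card_fin, Fintype.card_fin, Real.rpow_neg h0.le,
      Real.rpow_natCast, ← inv_pow, ← mul_pow]
    push_cast
    gcongr
    have : 1 ≤ ε⁻¹ := (one_le_inv₀ h0).2 h1.le
    rw [div_eq_mul_inv] at hM2
    nlinarith

end HasCoveringExponent

/-! ### Bi-Lipschitz cubes. -/

lemma norm_le_sqrt_of_mem_euclideanCube {d : ℕ} {x : EuclideanSpace ℝ (Fin d)}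
    (hx : x ∈ euclideanCube d) : ‖x‖ ≤ √d := by
  rw [EuclideanSpace.norm_eq]
  refine Real.sqrt_le_sqrt ?_
  calc ∑ i, ‖x i‖ ^ 2 ≤ ∑ i : Fin d, (1 : ℝ) := by
        gcongr with i
        rw [Real.norm_eq_abs, sq_abs]
        have := hx i
        nlinarith [this.1, this.2]
    _ = d := by simp

/-- A set that is bi-Lipschitz to a subset of `ℝ ^ d` with nonempty interior contains a
bi-Lipschitz cube. -/
lemma AdmitsBiLipschitzCube.of_ball_subset_image {X : Type*} [MetricSpace X] {d : ℕ} {A : Set X}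
    (f : X → EuclideanSpace ℝ (Fin d)) {C : ℝ≥0}
    (hf : ∀ y ∈ A, ∀ z ∈ A, edist y z ≤ C * edist (f y) (f z) ∧
      edist (f y) (f z) ≤ C * edist y z)
    {c : EuclideanSpace ℝ (Fin d)} {r : ℝ} (hr : 0 < r) (hA : Metric.ball c r ⊆ f '' A) :
    AdmitsBiLipschitzCube X d := by
  -- Scaled by `t`, the cube based at `c` fits in the open ball of radius `r`; the `+ 1` gives
  -- strictness and covers `d = 0`.
  set t : ℝ := r / (√d + 1) with ht
  have ht0 : 0 < t := by positivity
  have hmem : ∀ w : euclideanCube d, c + t • (w : EuclideanSpace ℝ (Fin d)) ∈ f '' A := by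
    intro w
    refine hA ?_
    rw [mem_ball_iff_norm, add_sub_cancel_left, norm_smul, Real.norm_of_nonneg ht0.le]
    calc t * ‖w.1‖ ≤ t * √d := by
          gcongr; exact norm_le_sqrt_of_mem_euclideanCube w.2
      _ < t * (√d + 1) := by gcongr; linarith
      _ = r := by rw [ht]; field_simp
  choose g hgA hg using hmem
  have hdist : ∀ w w' : euclideanCube d, edist (f (g w)) (f (g w')) =
      ENNReal.ofReal t * edist w w' := by
    intro w w'
    rw [hg, hg, edist_add_left, edist_smul₀, Subtype.edist_eq, ENNReal.smul_def, smul_eq_mul]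
    congr 1
    rw [← enorm_eq_nnnorm, Real.enorm_of_nonneg ht0.le]
  refine ⟨g, C * t.toNNReal, t⁻¹.toNNReal * C, fun w w' => ?_, fun w w' => ?_⟩
  · refine (hf _ (hgA w) _ (hgA w')).1.trans_eq ?_
    rw [hdist, ← mul_assoc, ENNReal.coe_mul]
    rfl
  · have h := (hf _ (hgA w) _ (hgA w')).2
    rw [hdist] at h
    calc edist w w' = ENNReal.ofReal t⁻¹ * (ENNReal.ofReal t * edist w w') := by
          rw [← mul_assoc, ← ENNReal.ofReal_mul (by positivity), inv_mul_cancel₀ ht0.ne']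
          simp
      _ ≤ ENNReal.ofReal t⁻¹ * (C * edist (g w) (g w')) := by gcongr
      _ = _ := by rw [← mul_assoc, ENNReal.coe_mul]; rfl

/-! ### Covering exponent and cubes of a Riemannian manifold. -/

section Manifold

variable {E : Type*} [NormedAddCommGroup E] [NormedSpace ℝ E] [FiniteDimensional ℝ E]
  {H : Type*} [TopologicalSpace H] {I : ModelWithCorners ℝ E H}
  {X : Type*} [MetricSpace X] [ChartedSpace H X]
  [Bundle.RiemannianBundle (fun x : X => TangentSpace I x)] [IsManifold I 1 X]
  [IsContinuousRiemannianBundle E (fun x : X => TangentSpace I x)]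

lemma IsLocallyRiemannian.exists_bilipschitz_toEuclidean (h : IsLocallyRiemannian I X) (x : X) :
    ∃ C : ℝ≥0, ∃ V ∈ 𝓝 x, ∀ y ∈ V, ∀ z ∈ V,
      edist y z ≤ C * edist (toEuclidean (extChartAt I x y)) (toEuclidean (extChartAt I x z)) ∧
      edist (toEuclidean (extChartAt I x y)) (toEuclidean (extChartAt I x z)) ≤
        C * edist y z := by
  obtain ⟨C, V, hV, hC⟩ := h.exists_bilipschitz_extChartAt x
  obtain ⟨K₁, h₁⟩ : ∃ K, LipschitzWith K (toEuclidean (E := E)) :=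
    ⟨_, ContinuousLinearEquiv.lipschitz _⟩
  obtain ⟨K₂, h₂⟩ : ∃ K, AntilipschitzWith K (toEuclidean (E := E)) :=
    ⟨_, ContinuousLinearEquiv.antilipschitz _⟩
  refine ⟨C * K₂ + K₁ * C, V, hV, fun y hy z hz => ⟨?_, ?_⟩⟩
  · refine (hC y hy z hz).1.trans ((mul_le_mul_right (h₂ _ _) _).trans ?_)
    rw [← mul_assoc, ← ENNReal.coe_mul]
    gcongr
    simp
  · refine (h₁ _ _).trans ((mul_le_mul_right (hC y hy z hz).2 _).trans ?_)
    rw [← mul_assoc, ← ENNReal.coe_mul]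
    gcongr
    simp

lemma IsLocallyRiemannian.hasCoveringExponent [CompactSpace X] (h : IsLocallyRiemannian I X) :
    HasCoveringExponent (univ : Set X) (Module.finrank ℝ E : ℝ) := by
  refine HasCoveringExponent.of_forall_nhds fun x => ?_
  obtain ⟨C, V, hV, hC⟩ := h.exists_bilipschitz_toEuclidean x
  have hcont : ContinuousAt (fun y => toEuclidean (extChartAt I x y)) x :=
    toEuclidean.continuous.continuousAt.comp (continuousAt_extChartAt x)
  refine ⟨_, inter_mem hV (hcont (Metric.ball_mem_nhds _ one_pos)),
    HasCoveringExponent.of_edist_le (fun y => toEuclidean (extChartAt I x y))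
      (c := toEuclidean (extChartAt I x x)) (fun y hy => hy.2)
      fun y hy z hz => (hC y hy.1 z hz.1).1⟩

/-- The base point may be a boundary point. Since the range of a model with corners lies in the
closure of its interior, the chart image of a neighbourhood still contains a ball, centred at a
nearby interior point. -/
lemma IsLocallyRiemannian.admitsBiLipschitzCube [Nonempty X] (h : IsLocallyRiemannian I X) :
    AdmitsBiLipschitzCube X (Module.finrank ℝ E) := by
  obtain ⟨x⟩ := ‹Nonempty X›
  obtain ⟨C, V, hV, hC⟩ := h.exists_bilipschitz_toEuclidean x
  have himage : extChartAt I x '' V ∈ 𝓝[range I] (extChartAt I x x) := by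
    rw [← map_extChartAt_nhds]
    exact image_mem_map hV
  obtain ⟨O, hO, hxO, hOV⟩ := mem_nhdsWithin.1 himage
  obtain ⟨c, hcO, hcI⟩ := mem_closure_iff.1
    (I.range_subset_closure_interior (extChartAt_target_subset_range x (mem_extChartAt_target x)))
    O hO hxO
  have hopen : IsOpen (toEuclidean '' (O ∩ interior (range I))) :=
    (toEuclidean (E := E)).toHomeomorph.isOpenMap _ (hO.inter isOpen_interior)
  obtain ⟨r, hr, hball⟩ := Metric.isOpen_iff.1 hopen _ (mem_image_of_mem _ ⟨hcO, hcI⟩)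
  refine .of_ball_subset_image (fun y => toEuclidean (extChartAt I x y)) hC
    (c := toEuclidean c) hr ?_
  intro w hw
  obtain ⟨e, he, rfl⟩ := hball hw
  obtain ⟨y, hy, rfl⟩ := hOV ⟨he.1, interior_subset he.2⟩
  exact ⟨y, hy, rfl⟩

end Manifold

/-! ### Couplings adapted to a partition. -/

section Coupling

variable {X : Type*} [MeasurableSpace X] {ι : Type*} [Fintype ι]

/-- Two finite measures of the same total mass admit a transport plan of that mass. -/
lemma exists_mem_transportPlans_of_measure_univ_eq (μ ν : Measure X) [IsFiniteMeasure μ]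
    [IsFiniteMeasure ν] (h : μ univ = ν univ) :
    ∃ ρ ∈ transportPlans μ ν, ρ univ = μ univ := by
  by_cases h0 : μ univ = 0
  · refine ⟨0, ⟨?_, ?_⟩, by simp [h0]⟩
    · simp [Measure.measure_univ_eq_zero.1 h0]
    · simp [Measure.measure_univ_eq_zero.1 (h ▸ h0)]
  refine ⟨(μ univ)⁻¹ • μ.prod ν, ⟨?_, ?_⟩, ?_⟩
  · rw [Measure.map_smul, Measure.map_fst_prod, ← h, smul_smul,
      ENNReal.inv_mul_cancel h0 (measure_ne_top _ _), one_smul]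
  · rw [Measure.map_smul, Measure.map_snd_prod, smul_smul,
      ENNReal.inv_mul_cancel h0 (measure_ne_top _ _), one_smul]
  · rw [Measure.smul_apply, ← univ_prod_univ, Measure.prod_prod, ← h, smul_eq_mul, ← mul_assoc,
      ENNReal.inv_mul_cancel h0 (measure_ne_top _ _), one_mul]

lemma transportPlans_add {μ μ' ν ν' : Measure X} {ρ ρ' : Measure (X × X)}
    (h : ρ ∈ transportPlans μ ν) (h' : ρ' ∈ transportPlans μ' ν') :
    ρ + ρ' ∈ transportPlans (μ + μ') (ν + ν') := by
  constructor
  · rw [Measure.map_add _ _ measurable_fst, h.1, h'.1]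
  · rw [Measure.map_add _ _ measurable_snd, h.2, h'.2]

lemma transportPlans_sum {μ ν : ι → Measure X} {ρ : ι → Measure (X × X)}
    (h : ∀ i, ρ i ∈ transportPlans (μ i) (ν i)) :
    ∑ i, ρ i ∈ transportPlans (∑ i, μ i) (∑ i, ν i) := by
  constructor
  · rw [← Measure.mapₗ_apply_of_measurable measurable_fst, map_sum]
    simp_rw [Measure.mapₗ_apply_of_measurable measurable_fst, (h _).1]
  · rw [← Measure.mapₗ_apply_of_measurable measurable_snd, map_sum]
    simp_rw [Measure.mapₗ_apply_of_measurable measurable_snd, (h _).2]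

variable [MetricSpace X]

lemma quadraticCost_le_of_ae_edist_le {ρ : Measure (X × X)} {ε : ℝ≥0∞}
    (h : ∀ᵐ z ∂ρ, edist z.1 z.2 ≤ ε) : quadraticCost ρ ≤ ε ^ 2 * ρ univ := by
  rw [← lintegral_const]
  refine lintegral_mono_ae ?_
  filter_upwards [h] with z hz
  gcongr

/-- Two probability measures giving nearly the same masses to the cells of a partition into small
cells are close for the Wasserstein distance. -/
lemma exists_transportPlan_of_partition (μ ν : Measure X) [IsProbabilityMeasure μ]
    [IsProbabilityMeasure ν] {B : ι → Set X} (hBm : ∀ i, MeasurableSet (B i))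
    (hBd : Pairwise (Function.onFun Disjoint B)) (hBu : ⋃ i, B i = univ) {ε D : ℝ≥0∞}
    (hε : ∀ i, Metric.ediam (B i) ≤ ε) (hD : Metric.ediam (univ : Set X) ≤ D) :
    ∃ ρ ∈ transportPlans μ ν, quadraticCost ρ ≤
      ε ^ 2 + D ^ 2 * ∑ i, (μ (B i) - ν (B i)) := by
  have hsum : ∀ (ξ : Measure X), ∑ i, ξ.restrict (B i) = ξ := fun ξ => by
    rw [← Measure.sum_fintype, ← Measure.restrict_iUnion hBd hBm, hBu, Measure.restrict_univ]
  have hsum1 : ∀ (ξ : Measure X) [IsProbabilityMeasure ξ], ∑ i, ξ (B i) = 1 := fun ξ _ => by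
    have := congrArg (fun m => m univ) (hsum ξ)
    simpa using this
  -- The mass common to both measures in each cell. It is coupled within the cell at cost at most `ε
  -- ^ 2` per unit mass.
  set a : ι → ℝ≥0∞ := fun i => min (μ (B i)) (ν (B i)) with ha
  -- Valid also for `m = 0`, which forces `x = 0`; cells of zero mass thus need no separate
  -- treatment.
  have frac : ∀ m x : ℝ≥0∞, m ≠ ∞ → x ≤ m → x / m * m = x ∧ x / m ≤ 1 := by
    intro m x hm hx
    refine ⟨ENNReal.div_mul_cancel' (fun h => by simpa [h] using hx) (fun h => absurd h hm),
      ENNReal.div_le_of_le_mul (by simpa using hx)⟩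
  have main : ∀ ξ : Measure X, IsProbabilityMeasure ξ → (∀ i, a i ≤ ξ (B i)) →
      (∑ i, ((a i / ξ (B i)) • ξ.restrict (B i))) +
        (∑ i, ((1 - a i / ξ (B i)) • ξ.restrict (B i))) = ξ := by
    intro ξ _ hξ
    conv_rhs => rw [← hsum ξ]
    rw [← Finset.sum_add_distrib]
    refine Finset.sum_congr rfl fun i _ => ?_
    rw [← add_smul, add_tsub_cancel_of_le (frac _ _ (measure_ne_top _ _) (hξ i)).2, one_smul]
  have rest : ∀ ξ : Measure X, IsProbabilityMeasure ξ → (∀ i, a i ≤ ξ (B i)) →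
      (∑ i, ((1 - a i / ξ (B i)) • ξ.restrict (B i))) univ = ∑ i, (ξ (B i) - a i) := by
    intro ξ _ hξ
    rw [Measure.finsetSum_apply]
    refine Finset.sum_congr rfl fun i _ => ?_
    rw [Measure.smul_apply, Measure.restrict_apply_univ, smul_eq_mul,
      ENNReal.sub_mul fun _ _ => measure_ne_top _ _, one_mul,
      (frac _ _ (measure_ne_top _ _) (hξ i)).1]
  have rest_eq : ∀ ξ : Measure X, IsProbabilityMeasure ξ → (∀ i, a i ≤ ξ (B i)) →
      ∑ i, (ξ (B i) - a i) = 1 - ∑ i, a i := by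
    intro ξ _ hξ
    have hfin : ∑ i, a i ≠ ∞ := ENNReal.sum_ne_top.2 fun i _ =>
      ((hξ i).trans_lt (measure_lt_top _ _)).ne
    refine ENNReal.eq_sub_of_add_eq hfin ?_
    rw [← Finset.sum_add_distrib, ← hsum1 ξ]
    exact Finset.sum_congr rfl fun i _ => tsub_add_cancel_of_le (hξ i)
  have haμ : ∀ i, a i ≤ μ (B i) := fun i => min_le_left _ _
  have haν : ∀ i, a i ≤ ν (B i) := fun i => min_le_right _ _
  have cell : ∀ i, ∃ ρ ∈ transportPlans ((a i / μ (B i)) • μ.restrict (B i))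
      ((a i / ν (B i)) • ν.restrict (B i)), ρ univ = a i := by
    intro i
    have e : ∀ ξ : Measure X, IsProbabilityMeasure ξ → (∀ i, a i ≤ ξ (B i)) →
        ((a i / ξ (B i)) • ξ.restrict (B i)) univ = a i := fun ξ _ hξ => by
      rw [Measure.smul_apply, Measure.restrict_apply_univ, smul_eq_mul,
        (frac _ _ (measure_ne_top _ _) (hξ i)).1]
    have fin : ∀ ξ : Measure X, IsProbabilityMeasure ξ → (∀ i, a i ≤ ξ (B i)) →
        IsFiniteMeasure ((a i / ξ (B i)) • ξ.restrict (B i)) := fun ξ _ hξ => by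
      constructor
      rw [e ξ ‹_› hξ]
      exact (hξ i).trans_lt (measure_lt_top _ _)
    have := fin μ ‹_› haμ
    have := fin ν ‹_› haν
    obtain ⟨ρ, hρ, h⟩ := exists_mem_transportPlans_of_measure_univ_eq
      ((a i / μ (B i)) • μ.restrict (B i)) ((a i / ν (B i)) • ν.restrict (B i))
      ((e μ ‹_› haμ).trans (e ν ‹_› haν).symm)
    exact ⟨ρ, hρ, h.trans (e μ ‹_› haμ)⟩
  choose ρ hρ hρa using cell
  -- The leftovers of both measures have the same mass `1 - ∑ i, a i`, so they can be coupled
  -- arbitrarily, at cost at most `D ^ 2` per unit mass.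
  obtain ⟨ρ', hρ', hρ'u⟩ : ∃ ρ' ∈ transportPlans
      (∑ i, ((1 - a i / μ (B i)) • μ.restrict (B i)))
      (∑ i, ((1 - a i / ν (B i)) • ν.restrict (B i))), ρ' univ = ∑ i, (μ (B i) - a i) := by
    have fin : ∀ ξ : Measure X, IsProbabilityMeasure ξ → (∀ i, a i ≤ ξ (B i)) →
        IsFiniteMeasure (∑ i, ((1 - a i / ξ (B i)) • ξ.restrict (B i))) := fun ξ _ hξ => by
      constructor
      rw [rest ξ ‹_› hξ, rest_eq ξ ‹_› hξ]
      exact tsub_le_self.trans_lt ENNReal.one_lt_top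
    have := fin μ ‹_› haμ
    have := fin ν ‹_› haν
    obtain ⟨ρ', h₁, h₂⟩ := exists_mem_transportPlans_of_measure_univ_eq
      (∑ i, ((1 - a i / μ (B i)) • μ.restrict (B i)))
      (∑ i, ((1 - a i / ν (B i)) • ν.restrict (B i)))
      (by rw [rest μ ‹_› haμ, rest ν ‹_› haν, rest_eq μ ‹_› haμ, rest_eq ν ‹_› haν])
    exact ⟨ρ', h₁, h₂.trans (rest μ ‹_› haμ)⟩
  refine ⟨∑ i, ρ i + ρ', ?_, ?_⟩
  · have := transportPlans_add (transportPlans_sum hρ) hρ'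
    rwa [main μ ‹_› haμ, main ν ‹_› haν] at this
  · rw [quadraticCost, lintegral_add_measure]
    refine add_le_add ?_ ?_
    · rw [lintegral_finsetSum_measure]
      calc ∑ i, ∫⁻ z, edist z.1 z.2 ^ 2 ∂ρ i ≤ ∑ i, ε ^ 2 * a i := by
            gcongr with i
            rw [← hρa i]
            refine quadraticCost_le_of_ae_edist_le ?_
            have h₁ : ∀ᵐ z ∂ρ i, z.1 ∈ B i := by
              refine ae_of_ae_map (p := fun x => x ∈ B i) measurable_fst.aemeasurable ?_
              rw [(hρ i).1]
              exact Measure.ae_smul_measure (ae_restrict_mem (hBm i)) _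
            have h₂ : ∀ᵐ z ∂ρ i, z.2 ∈ B i := by
              refine ae_of_ae_map (p := fun x => x ∈ B i) measurable_snd.aemeasurable ?_
              rw [(hρ i).2]
              exact Measure.ae_smul_measure (ae_restrict_mem (hBm i)) _
            filter_upwards [h₁, h₂] with z hz₁ hz₂
            exact (Metric.edist_le_ediam_of_mem hz₁ hz₂).trans (hε i)
        _ = ε ^ 2 * ∑ i, a i := by rw [Finset.mul_sum]
        _ ≤ ε ^ 2 * ∑ i, μ (B i) := by gcongr with i; exact haμ i
        _ = ε ^ 2 := by rw [hsum1, mul_one]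
    · refine (quadraticCost_le_of_ae_edist_le (ε := D) (ae_of_all _ fun z =>
        (Metric.edist_le_ediam_of_mem (mem_univ _) (mem_univ _)).trans hD)).trans ?_
      rw [hρ'u]
      refine mul_le_mul_right (Finset.sum_le_sum fun i _ => ?_) _
      exact tsub_min.le

end Coupling

/-! ### Upper bound: counting measures by rounded cell masses. -/

section UpperBound

lemma powerExpScale_zero (s : ℝ) : powerExpScale s 0 = 0 := if_pos rfl

lemma powerExpScale_of_ne_zero (s : ℝ) {r : ℝ} (hr : r ≠ 0) :
    powerExpScale s r = Real.exp (-(1 / r) ^ s) := if_neg hr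

lemma powerExpScale_le {s r r' : ℝ} (hs : 0 < s) (h0 : 0 ≤ r) (h : r ≤ r') (hr' : 0 < r') :
    powerExpScale s r ≤ Real.exp (-(1 / r') ^ s) := by
  rcases h0.eq_or_lt with rfl | h0
  · rw [powerExpScale_zero]; positivity
  · rw [powerExpScale_of_ne_zero s h0.ne']
    gcongr

/-- Finite coverings suffice to bound Carathéodory's construction from above. -/
lemma caratheodoryMeasure_le_of_finite_covers {X : Type*} [MetricSpace X] {f : ℝ → ℝ}
    (hf : f 0 = 0) {A : Set X} {c : ℝ≥0∞}
    (h : ∀ δ : ℝ, 0 < δ → ∃ (ι : Type) (_ : Fintype ι) (E : ι → Set X), A ⊆ ⋃ i, E i ∧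
      (∀ i, Metric.ediam (E i) ≤ ENNReal.ofReal δ) ∧
      ∑ i, ENNReal.ofReal (f (Metric.diam (E i))) ≤ c) :
    caratheodoryMeasure f A ≤ c := by
  refine iSup₂_le fun δ hδ => ?_
  obtain ⟨ι, _, E, hA, hE, hc⟩ := h δ hδ
  -- The finite family becomes a sequence of closed sets by taking closures and padding with empty
  -- sets, which contribute `f 0 = 0`.
  let := Fintype.toEncodable ι
  have hc' : ∑' n, ENNReal.ofReal (f (Metric.diam
      (⋃ b ∈ Encodable.decode₂ ι n, closure (E b)))) ≤ c := by
    rw [tsum_iUnion_decode₂ (fun s : Set X => ENNReal.ofReal (f (Metric.diam s)))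
      (by simp [hf]), tsum_fintype]
    simpa only [Metric.diam_closure] using hc
  refine le_trans ?_ hc'
  refine iInf_le_of_le _ (iInf_le_of_le ?_ (iInf_le_of_le ?_ le_rfl))
  · rw [Encodable.iUnion_decode₂]
    exact hA.trans (iUnion_mono fun i => subset_closure)
  · refine fun n => Encodable.iUnion_decode₂_cases
      (C := fun s => IsClosed s ∧ Metric.ediam s ≤ ENNReal.ofReal δ) (by simp) fun i => ?_
    exact ⟨isClosed_closure, by rw [Metric.ediam_closure]; exact hE i⟩

/-- Closures make the cells Borel at no cost in diameter; the index type `Fin` provides the order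
along which earlier cells are removed. -/
lemma exists_measurable_partition {X : Type*} [MetricSpace X] [MeasurableSpace X]
    [BorelSpace X] {ι : Type*} [Fintype ι] {A : ι → Set X} {ε : ℝ≥0∞} (hA : univ ⊆ ⋃ i, A i)
    (hε : ∀ i, Metric.ediam (A i) ≤ ε) :
    ∃ B : Fin (Fintype.card ι) → Set X, (∀ i, MeasurableSet (B i)) ∧
      Pairwise (Function.onFun Disjoint B) ∧ ⋃ i, B i = univ ∧
      ∀ i, Metric.ediam (B i) ≤ ε := by
  set F : Fin (Fintype.card ι) → Set X := fun i => closure (A ((Fintype.equivFin ι).symm i))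
  refine ⟨disjointed F, fun i => ?_, disjoint_disjointed F, ?_, fun i => ?_⟩
  · rw [disjointed_apply, Finset.sup_set_eq_biUnion]
    exact isClosed_closure.measurableSet.diff
      (Finset.measurableSet_biUnion _ fun j _ => isClosed_closure.measurableSet)
  · rw [iUnion_disjointed, ← univ_subset_iff]
    refine hA.trans (iUnion_subset fun i => ?_)
    refine subset_iUnion_of_subset (Fintype.equivFin ι i) ?_
    simpa [F] using subset_closure
  · refine (Metric.ediam_mono (disjointed_subset F i)).trans ?_
    rw [Metric.ediam_closure]
    exact hε _

variable {X : Type*} [MetricSpace X] [CompactSpace X] [MeasurableSpace X] [BorelSpace X]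

/-- Equal rounded masses differ by at most `1 / M` in each cell, so the partition coupling costs at
most `ε ^ 2 + D ^ 2 * n / M`, where `D` is the diameter of `X` and `n` the number of cells. The
condition on `M` bounds the second term by `3 * ε ^ 2`. -/
lemma WassersteinSpace.edist_le_of_floor_eq {ι : Type*} [Fintype ι] {B : ι → Set X}
    (hBm : ∀ i, MeasurableSet (B i)) (hBd : Pairwise (Function.onFun Disjoint B))
    (hBu : ⋃ i, B i = univ) {ε : ℝ} (hε0 : 0 ≤ ε)
    (hε : ∀ i, Metric.ediam (B i) ≤ ENNReal.ofReal ε) {M : ℕ} (hM : 0 < M)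
    (hMc : Fintype.card ι * Metric.diam (univ : Set X) ^ 2 ≤ 3 * ε ^ 2 * M)
    {μ ν : WassersteinSpace X} (h : ∀ i, ⌊M * μ.1.real (B i)⌋₊ = ⌊M * ν.1.real (B i)⌋₊) :
    edist μ ν ≤ ENNReal.ofReal (2 * ε) := by
  have hM0 : (0 : ℝ) < M := by exact_mod_cast hM
  have hD : Metric.ediam (univ : Set X) ≤ ENNReal.ofReal (Metric.diam (univ : Set X)) :=
    (ENNReal.ofReal_toReal isCompact_univ.isBounded.ediam_ne_top).ge
  obtain ⟨ρ, hρ, hcost⟩ := exists_transportPlan_of_partition μ.1 ν.1 hBm hBd hBu hε hD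
  have hi : ∀ i, μ.1 (B i) - ν.1 (B i) ≤ ENNReal.ofReal (1 / M) := by
    intro i
    rw [← ofReal_measureReal, ← ofReal_measureReal, ← ENNReal.ofReal_sub _ measureReal_nonneg]
    refine ENNReal.ofReal_le_ofReal ?_
    have h₁ := Nat.lt_floor_add_one (M * μ.1.real (B i))
    have h₂ := Nat.floor_le (show 0 ≤ M * ν.1.real (B i) by positivity)
    rw [h i] at h₁
    rw [le_div_iff₀ hM0]
    linarith
  have hcost' : quadraticCost ρ ≤ ENNReal.ofReal (2 * ε) ^ 2 := by
    calc quadraticCost ρ ≤ ENNReal.ofReal ε ^ 2 + ENNReal.ofReal (Metric.diam (univ : Set X)) ^ 2 *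
          ∑ i, (μ.1 (B i) - ν.1 (B i)) := hcost
      _ ≤ ENNReal.ofReal ε ^ 2 + ENNReal.ofReal (Metric.diam (univ : Set X)) ^ 2 *
          ∑ i : ι, ENNReal.ofReal (1 / M) := by gcongr with i; exact hi i
      _ = ENNReal.ofReal (ε ^ 2 +
          Metric.diam (univ : Set X) ^ 2 * (Fintype.card ι * (1 / M))) := by
        rw [Finset.sum_const, Finset.card_univ, nsmul_eq_mul,
          ENNReal.ofReal_add (by positivity) (by positivity), ENNReal.ofReal_mul (by positivity),
          ENNReal.ofReal_pow hε0, ENNReal.ofReal_pow Metric.diam_nonneg,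
          ENNReal.ofReal_mul (by positivity), ENNReal.ofReal_natCast]
      _ ≤ ENNReal.ofReal ((2 * ε) ^ 2) := by
        refine ENNReal.ofReal_le_ofReal ?_
        have : Metric.diam (univ : Set X) ^ 2 * (Fintype.card ι * (1 / M)) ≤ 3 * ε ^ 2 := by
          rw [mul_one_div, ← mul_div_assoc, div_le_iff₀ hM0]
          linarith
        linarith
      _ = ENNReal.ofReal (2 * ε) ^ 2 := ENNReal.ofReal_pow (by positivity) _
  rw [WassersteinSpace.edist_def]
  refine (wassersteinEDist_le_of_mem hρ).trans
    ((ENNReal.rpow_le_rpow hcost' (by norm_num)).trans_eq ?_)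
  rw [← ENNReal.rpow_natCast, ← ENNReal.rpow_mul]
  norm_num

/-- A covering of `X` by `n` sets of diameter at most `ε` gives a covering of its Wasserstein space
by `(M + 1) ^ n` sets of diameter at most `2 * ε` as soon as `M` is at least of order `n / ε ^ 2`. -/
lemma WassersteinSpace.exists_finite_cover {ι : Type*} [Fintype ι] {A : ι → Set X} {ε : ℝ}
    (hε0 : 0 ≤ ε) (hA : univ ⊆ ⋃ i, A i) (hε : ∀ i, Metric.ediam (A i) ≤ ENNReal.ofReal ε)
    {M : ℕ} (hM : 0 < M)
    (hMc : Fintype.card ι * Metric.diam (univ : Set X) ^ 2 ≤ 3 * ε ^ 2 * M) :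
    ∃ E : (Fin (Fintype.card ι) → Fin (M + 1)) → Set (WassersteinSpace X),
      univ ⊆ ⋃ i, E i ∧ ∀ i, Metric.ediam (E i) ≤ ENNReal.ofReal (2 * ε) := by
  obtain ⟨B, hBm, hBd, hBu, hBε⟩ := exists_measurable_partition hA hε
  refine ⟨fun k => {μ | ∀ i, ⌊M * μ.1.real (B i)⌋₊ = k i}, fun μ _ => ?_, fun k => ?_⟩
  · have hlt : ∀ i, ⌊M * μ.1.real (B i)⌋₊ < M + 1 := fun i => by
      rw [Nat.floor_lt (by positivity)]
      push_cast
      have : μ.1.real (B i) ≤ 1 := measureReal_le_one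
      have : (M : ℝ) * μ.1.real (B i) ≤ M := mul_le_of_le_one_right (by positivity) this
      linarith
    exact mem_iUnion.2 ⟨fun i => ⟨_, hlt i⟩, fun i => rfl⟩
  · exact Metric.ediam_le fun μ hμ ν hν => WassersteinSpace.edist_le_of_floor_eq hBm hBd hBu hε0 hBε
      hM (by simpa using hMc) fun i => (hμ i).trans (hν i).symm

/-- With `t = 1 / ε`, the left side bounds the logarithm of the covering number of the Wasserstein
space; a strictly larger exponent absorbs the logarithm. -/
lemma eventually_mul_rpow_mul_log_le {s₁ s : ℝ} (h : s₁ < s) (C a b : ℝ) {c : ℝ} (hc : 0 < c) :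
    ∀ᶠ t : ℝ in atTop, C * t ^ s₁ * (a + b * Real.log t) ≤ c * t ^ s := by
  have h0 : 0 < s - s₁ := sub_pos.2 h
  have h₁ : (fun t : ℝ => C * (a + b * Real.log t)) =o[atTop] fun t => t ^ (s - s₁) := by
    refine Asymptotics.IsLittleO.const_mul_left (.add ?_ ?_) _
    · exact (Asymptotics.isLittleO_const_left.2 (Or.inr
        (tendsto_norm_atTop_atTop.comp (tendsto_rpow_atTop h0))))
    · exact (isLittleO_log_rpow_atTop h0).const_mul_left _
  filter_upwards [h₁.bound hc, eventually_gt_atTop 0] with t ht ht0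
  have hpos : 0 < t ^ (s - s₁) := Real.rpow_pos_of_pos ht0 _
  have ht' : C * (a + b * Real.log t) ≤ c * t ^ (s - s₁) := by
    refine (le_abs_self _).trans ?_
    rwa [Real.norm_eq_abs, Real.norm_of_nonneg hpos.le] at ht
  calc C * t ^ s₁ * (a + b * Real.log t) = t ^ s₁ * (C * (a + b * Real.log t)) := by ring
    _ ≤ t ^ s₁ * (c * t ^ (s - s₁)) := by
      have := Real.rpow_pos_of_pos ht0 s₁
      gcongr
    _ = c * t ^ s := by
      rw [mul_left_comm, ← Real.rpow_add ht0]
      congr 2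
      ring

lemma HasCoveringExponent.caratheodoryMeasure_wassersteinSpace_le {s₁ s : ℝ} (hs₁ : 0 ≤ s₁)
    (hs : s₁ < s) (h : HasCoveringExponent (univ : Set X) s₁) :
    caratheodoryMeasure (powerExpScale s) (univ : Set (WassersteinSpace X)) ≤ 1 := by
  refine caratheodoryMeasure_le_of_finite_covers (powerExpScale_zero s) fun δ hδ => ?_
  have hs0 : 0 < s := hs₁.trans_lt hs
  obtain ⟨C, hC⟩ := h
  set D := Metric.diam (univ : Set X)
  -- `K` is such that `M + 1 ≤ K * ε⁻¹ ^ (s₁ + 2)`. The factor `2⁻¹ ^ s` below compensates for the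
  -- covering sets having diameter up to `2 * ε` rather than `ε`.
  set K : ℝ := |C| * D ^ 2 + 3 with hK
  have hK0 : 0 < K := by positivity
  have hlog := tendsto_inv_nhdsGT_zero.eventually (eventually_mul_rpow_mul_log_le hs |C|
    (Real.log K) (s₁ + 2) (c := (2⁻¹ : ℝ) ^ s) (by positivity))
  have hδ1 : 0 < min 1 (δ / 2) := by positivity
  obtain ⟨ε, ⟨ι, _, A, hA, hAε, hcard⟩, hε, hε0, hε1⟩ :=
    (hC.and (hlog.and (Ioo_mem_nhdsGT hδ1))).exists
  replace hcard := hcard.trans (mul_le_mul_of_nonneg_right (le_abs_self C)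
    (Real.rpow_nonneg hε0.le _))
  rw [Real.rpow_neg hε0.le, ← Real.inv_rpow hε0.le] at hcard
  have hε1' : 1 ≤ ε⁻¹ := (one_le_inv₀ hε0).2 (hε1.le.trans (min_le_left _ _))
  have hεδ : 2 * ε ≤ δ := by linarith [hε1.le.trans (min_le_right _ _)]
  set n := Fintype.card ι
  set M : ℕ := ⌈n * D ^ 2 * ε⁻¹ ^ 2⌉₊ + 1 with hM
  have hMc : n * D ^ 2 ≤ 3 * ε ^ 2 * M := by
    have h₁ : n * D ^ 2 * ε⁻¹ ^ 2 ≤ M := by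
      rw [hM]; push_cast; linarith [Nat.le_ceil (n * D ^ 2 * ε⁻¹ ^ 2)]
    calc n * D ^ 2 = ε ^ 2 * (n * D ^ 2 * ε⁻¹ ^ 2) := by field_simp
      _ ≤ ε ^ 2 * M := by gcongr
      _ ≤ 3 * ε ^ 2 * M := by gcongr; nlinarith
  obtain ⟨E, hE, hEd⟩ := WassersteinSpace.exists_finite_cover hε0.le hA hAε
    (M := M) (by omega) hMc
  refine ⟨_, inferInstance, E, hE, fun i => (hEd i).trans (ENNReal.ofReal_le_ofReal hεδ), ?_⟩
  have hdiam : ∀ i, Metric.diam (E i) ≤ 2 * ε := fun i =>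
    ENNReal.toReal_le_of_le_ofReal (by positivity) (hEd i)
  have hM1 : (M : ℝ) + 1 ≤ K * ε⁻¹ ^ (s₁ + 2) := by
    have h₂ : (1 : ℝ) ≤ ε⁻¹ ^ (s₁ + 2) := Real.one_le_rpow hε1' (by linarith)
    calc (M : ℝ) + 1 ≤ n * D ^ 2 * ε⁻¹ ^ 2 + 3 := by
          rw [hM]; push_cast
          linarith [Nat.ceil_lt_add_one (show 0 ≤ n * D ^ 2 * ε⁻¹ ^ 2 by positivity)]
      _ ≤ (|C| * ε⁻¹ ^ s₁) * D ^ 2 * ε⁻¹ ^ 2 + 3 * ε⁻¹ ^ (s₁ + 2) := by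
          gcongr; linarith
      _ = K * ε⁻¹ ^ (s₁ + 2) := by
          rw [Real.rpow_add (by positivity), Real.rpow_two, hK]; ring
  have hexp : ((M : ℝ) + 1) ^ n ≤ Real.exp ((1 / (2 * ε)) ^ s) := by
    have hM0 : (0 : ℝ) < M + 1 := by positivity
    rw [← Real.rpow_natCast, Real.rpow_def_of_pos hM0]
    refine Real.exp_le_exp.2 ?_
    have hl0 : 0 ≤ Real.log (M + 1) := Real.log_nonneg (by linarith [(Nat.cast_nonneg M : (0:ℝ) ≤ M)])
    have hl : Real.log (M + 1) ≤ Real.log K + (s₁ + 2) * Real.log ε⁻¹ := by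
      rw [← Real.log_rpow (by positivity), ← Real.log_mul hK0.ne' (by positivity)]
      exact Real.log_le_log hM0 hM1
    calc Real.log (M + 1) * n ≤ (Real.log K + (s₁ + 2) * Real.log ε⁻¹) * (|C| * ε⁻¹ ^ s₁) := by
          gcongr
          exact hl0.trans hl
      _ ≤ 2⁻¹ ^ s * ε⁻¹ ^ s := by rw [mul_comm]; exact hε
      _ = (1 / (2 * ε)) ^ s := by
          rw [← Real.mul_rpow (by positivity) (by positivity)]; congr 1; field_simp
  calc ∑ i, ENNReal.ofReal (powerExpScale s (Metric.diam (E i)))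
      ≤ ∑ i : Fin n → Fin (M + 1), ENNReal.ofReal (Real.exp (-(1 / (2 * ε)) ^ s)) := by
        gcongr with i
        exact powerExpScale_le hs0 Metric.diam_nonneg (hdiam i) (by positivity)
    _ = ENNReal.ofReal ((M + 1) ^ n * Real.exp (-(1 / (2 * ε)) ^ s)) := by
        rw [Finset.sum_const, Finset.card_univ, Fintype.card_fun, Fintype.card_fin,
          Fintype.card_fin, nsmul_eq_mul, ENNReal.ofReal_mul (by positivity),
          ENNReal.ofReal_pow (by positivity)]
        congr 1
        rw [← Nat.cast_succ, ENNReal.ofReal_natCast]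
        push_cast; rfl
    _ ≤ ENNReal.ofReal 1 := by
        refine ENNReal.ofReal_le_ofReal ?_
        rw [Real.exp_neg, ← div_eq_mul_inv]
        exact div_le_one_of_le₀ hexp (Real.exp_pos _).le
    _ = 1 := ENNReal.ofReal_one

lemma critParam_wassersteinSpace_le {d : ℕ}
    (h : ∀ s : ℝ, d < s → HasCoveringExponent (univ : Set X) s) :
    critParam powerExpScale (univ : Set (WassersteinSpace X)) ≤ d := by
  refine iSup_le fun s => iSup₂_le fun hs htop => ?_
  by_contra! hlt
  have hds : (d : ℝ) < s := by
    rw [← ENNReal.ofReal_natCast] at hlt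
    exact (ENNReal.ofReal_lt_ofReal_iff hs).1 hlt
  -- Room on both sides: coverings are given only for exponents above `d`, and the logarithm needs
  -- `s₁ < s`.
  obtain ⟨s₁, hds₁, hs₁⟩ := exists_between hds
  have := (h s₁ hds₁).caratheodoryMeasure_wassersteinSpace_le
    ((Nat.cast_nonneg d).trans hds₁.le) hs₁
  rw [htop] at this
  exact absurd this (by simp)

end UpperBound

/-- Balls of radius `ε / 2` have diameter at most `ε`; halving the radius only costs the constant `2
^ s'`. -/
lemma HasCoveringExponent.of_upperMinkowskiDim_lt {X : Type*} [MetricSpace X] {s : ℝ}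
    (h : upperMinkowskiDim X < ENNReal.ofReal s) : HasCoveringExponent (univ : Set X) s := by
  simp only [upperMinkowskiDim, iInf_lt_iff] at h
  obtain ⟨s', hs', hlim, hlt⟩ := h
  refine HasCoveringExponent.mono_exponent ?_ (ENNReal.ofReal_lt_ofReal_iff'.1 hlt).1.le
  obtain ⟨K, hK, hKtop⟩ := exists_between hlim
  have hev := eventually_lt_of_limsup_lt hK
  have htend : Tendsto (fun ε : ℝ => (ε / 2).toNNReal) (𝓝[>] 0) (𝓝[>] 0) := by
    refine tendsto_nhdsWithin_iff.2 ⟨?_, ?_⟩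
    · have : Continuous fun ε : ℝ => (ε / 2).toNNReal := by fun_prop
      exact (this.tendsto' 0 0 (by simp)).mono_left nhdsWithin_le_nhds
    · filter_upwards [self_mem_nhdsWithin] with ε hε
      exact Real.toNNReal_pos.2 (half_pos hε)
  refine ⟨K.toReal * 2 ^ s', ?_⟩
  filter_upwards [htend.eventually hev, self_mem_nhdsWithin] with ε hcov hε
  have hε0 : (0 : ℝ) < ε := hε
  set r : ℝ≥0 := (ε / 2).toNNReal with hr
  have hr0 : 0 < r := Real.toNNReal_pos.2 (half_pos hε0)
  have hrε : (r : ℝ) = ε / 2 := Real.coe_toNNReal _ (half_pos hε0).le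
  have hrs : (r : ℝ≥0∞) ^ s' = ENNReal.ofReal ((ε / 2) ^ s') := by
    rw [← ENNReal.ofReal_rpow_of_pos (half_pos hε0)]; rfl
  have hpos : 0 < (ε / 2) ^ s' := by positivity
  have hne : Metric.coveringNumber r (univ : Set X) ≠ ⊤ := by
    intro htop
    rw [htop, hrs, ENat.toENNReal_top, ENNReal.top_mul (by simpa using hpos)] at hcov
    exact absurd hcov (by simp)
  obtain ⟨C, -, hCfin, hC, hCcard⟩ := Metric.exists_set_encard_eq_coveringNumber hne
  have := hCfin.fintype
  refine ⟨Fin (Fintype.card C), inferInstance,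
    fun i => Metric.closedBall ((Fintype.equivFin C).symm i : X) r, ?_, fun i => ?_, ?_⟩
  · refine (Metric.isCover_iff_subset_iUnion_closedBall.1 hC).trans (iUnion₂_subset fun x hx => ?_)
    refine subset_iUnion_of_subset (Fintype.equivFin C ⟨x, hx⟩) ?_
    simp
  · refine Metric.ediam_le fun y hy z hz => ?_
    rw [edist_dist]
    refine ENNReal.ofReal_le_ofReal ?_
    have := dist_triangle_right y z ((Fintype.equivFin C).symm i : X)
    have hy' := Metric.mem_closedBall.1 hy
    have hz' := Metric.mem_closedBall.1 hz
    linarith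
  · rw [← hCcard, ← Set.coe_fintypeCard, ENat.toENNReal_coe, hrs] at hcov
    have h₂ : (Fintype.card C : ℝ) * (ε / 2) ^ s' ≤ K.toReal := by
      have := ENNReal.toReal_mono hKtop.ne hcov.le
      rwa [ENNReal.toReal_mul, ENNReal.toReal_natCast, ENNReal.toReal_ofReal hpos.le] at this
    rw [Fintype.card_fin, Real.rpow_neg hε0.le, ← div_eq_mul_inv, le_div_iff₀ (by positivity)]
    rw [Real.div_rpow hε0.le (by norm_num), ← mul_div_assoc, div_le_iff₀ (by positivity)] at h₂
    exact h₂

/-! ### Random measures from independent coin flips. -/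

section RandomMeasure

/-- A Chernoff-type bound for the cardinality of a Hamming ball of radius `n / 8`. -/
lemma card_hammingDist_le {T : Type*} [Fintype T] [DecidableEq T] (η₀ : T → Bool) :
    (Fintype.card {η : T → Bool // 8 * hammingDist η η₀ ≤ Fintype.card T} : ℝ) ≤
      (5 / 3) ^ Fintype.card T := by
  set N := Fintype.card T
  have hsum : ∑ η : T → Bool, (1 / 2 : ℝ) ^ hammingDist η η₀ = (3 / 2) ^ N := by
    have h₁ : ∀ η : T → Bool, (1 / 2 : ℝ) ^ hammingDist η η₀ =
        ∏ i, if η i ≠ η₀ i then (1 / 2 : ℝ) else 1 := fun η => by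
      rw [Finset.prod_ite, Finset.prod_const, Finset.prod_const_one, mul_one]
      rfl
    simp_rw [h₁]
    rw [← Fintype.prod_sum fun i (b : Bool) => if b ≠ η₀ i then (1 / 2 : ℝ) else 1]
    have h₂ : ∀ i, ∑ b : Bool, (if b ≠ η₀ i then (1 / 2 : ℝ) else 1) = 3 / 2 := fun i => by
      cases η₀ i <;> norm_num
    simp_rw [h₂]
    rw [Finset.prod_const, Finset.card_univ]
  rw [Fintype.card_subtype]
  calc ((Finset.univ.filter fun η : T → Bool => 8 * hammingDist η η₀ ≤ N).card : ℝ)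
      = ∑ η ∈ Finset.univ.filter fun η : T → Bool => 8 * hammingDist η η₀ ≤ N, (1 : ℝ) := by simp
    _ ≤ ∑ η ∈ Finset.univ.filter fun η : T → Bool => 8 * hammingDist η η₀ ≤ N,
        (10 / 9 : ℝ) ^ N * (1 / 2 : ℝ) ^ hammingDist η η₀ := by
      refine Finset.sum_le_sum fun η hη => ?_
      have hη := (Finset.mem_filter.1 hη).2
      -- Exponential Markov inequality with weight `1 / 2` per disagreement: on the ball the weight
      -- is at least `2 ^ (-N / 8) ≥ (9 / 10) ^ N`, as `2 ≤ (10 / 9) ^ 8`. The result is `(10 / 9 *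
      -- (3 / 2)) ^ N = (5 / 3) ^ N`.
      have h : (2 : ℝ) ^ hammingDist η η₀ ≤ (10 / 9) ^ N := by
        refine le_of_pow_le_pow_left₀ (n := 8) (by norm_num) (by positivity) ?_
        calc ((2 : ℝ) ^ hammingDist η η₀) ^ 8 = 2 ^ (8 * hammingDist η η₀) := by
              rw [← pow_mul, mul_comm]
          _ ≤ 2 ^ N := pow_le_pow_right₀ (by norm_num) hη
          _ ≤ ((10 / 9 : ℝ) ^ 8) ^ N := by gcongr; norm_num
          _ = ((10 / 9 : ℝ) ^ N) ^ 8 := by rw [← pow_mul, ← pow_mul, mul_comm]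
      rw [one_div, inv_pow, ← div_eq_mul_inv, le_div_iff₀ (by positivity), one_mul]
      exact h
    _ ≤ ∑ η : T → Bool, (10 / 9 : ℝ) ^ N * (1 / 2 : ℝ) ^ hammingDist η η₀ :=
      Finset.sum_le_sum_of_subset_of_nonneg (Finset.filter_subset _ _) fun _ _ _ => by positivity
    _ = (5 / 3) ^ N := by
      rw [← Finset.mul_sum, hsum, ← mul_pow]
      norm_num

lemma uniformOfFintype_hammingDist_le {T : Type*} [Fintype T] [DecidableEq T] (η₀ : T → Bool) :
    (PMF.uniformOfFintype (T → Bool)).toMeasure {η | 8 * hammingDist η η₀ ≤ Fintype.card T} ≤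
      ENNReal.ofReal ((5 / 6) ^ Fintype.card T) := by
  rw [PMF.toMeasure_uniformOfFintype_apply _ (Set.toFinite _).measurableSet, Fintype.card_fun,
    Fintype.card_bool]
  refine ENNReal.div_le_of_le_mul ?_
  have h2 : (((2 ^ Fintype.card T : ℕ)) : ℝ≥0∞) = ENNReal.ofReal (2 ^ Fintype.card T) := by
    rw [ENNReal.ofReal_pow (by norm_num)]; simp
  rw [h2, ← ENNReal.ofReal_mul (by positivity), ← mul_pow, ← ENNReal.ofReal_natCast]
  refine ENNReal.ofReal_le_ofReal ?_
  norm_num only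
  exact card_hammingDist_le η₀

variable {X : Type*} [MeasurableSpace X] {T : ℕ → Type*} [∀ k, Fintype (T k)]

/-- Given pairs of points indexed by the levels `k` and by `T k`, and a choice `ω` of one point in
each pair, the measure giving mass `2 ^ (-(k + 1))` to the level `k`, uniformly distributed among
the chosen points. -/
noncomputable def choiceMeasure (p : (Σ k, T k × Bool) → X) (ω : ∀ k, T k → Bool) : Measure X :=
  Measure.sum fun k => ((2⁻¹ : ℝ≥0∞) ^ (k + 1) / Fintype.card (T k)) •
    ∑ j, Measure.dirac (p ⟨k, j, ω k j⟩)

lemma isProbabilityMeasure_choiceMeasure [∀ k, Nonempty (T k)] (p : (Σ k, T k × Bool) → X)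
    (ω : ∀ k, T k → Bool) : IsProbabilityMeasure (choiceMeasure p ω) := by
  constructor
  rw [choiceMeasure, Measure.sum_apply _ MeasurableSet.univ]
  have h : ∀ k, (((2⁻¹ : ℝ≥0∞) ^ (k + 1) / Fintype.card (T k)) •
      ∑ j, Measure.dirac (p ⟨k, j, ω k j⟩)) univ = 2⁻¹ ^ (k + 1) := fun k => by
    rw [Measure.smul_apply, Measure.finsetSum_apply]
    simp only [measure_univ, Finset.sum_const, Finset.card_univ, nsmul_eq_mul, mul_one, smul_eq_mul]
    exact ENNReal.div_mul_cancel (by simp) (by simp)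
  simp_rw [h]
  rw [ENNReal.tsum_geometric_add_one, ENNReal.one_sub_inv_two, inv_inv,
    ENNReal.inv_mul_cancel (by simp) (by simp)]

variable [MetricSpace X] {p : (Σ k, T k × Bool) → X} {r : ℕ → ℝ≥0∞}

/-- If every point is at distance at least `r k` from the others, then transporting one choice
measure onto another costs at least `r k ^ 2` times the mass at the level `k` of the points that
have to be moved. -/
lemma hammingDist_mul_le_quadraticCost [BorelSpace X] [SecondCountableTopology X]
    (hp : ∀ a b, a ≠ b → r a.1 ≤ edist (p a) (p b)) {ω ω' : ∀ k, T k → Bool}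
    {ρ : Measure (X × X)} (hρ : ρ ∈ transportPlans (choiceMeasure p ω) (choiceMeasure p ω'))
    (k : ℕ) :
    hammingDist (ω k) (ω' k) * ((2⁻¹ : ℝ≥0∞) ^ (k + 1) / Fintype.card (T k)) * r k ^ 2 ≤
      quadraticCost ρ := by
  classical
  set J := Finset.univ.filter fun j => ω k j ≠ ω' k j with hJ
  -- `F` collects the points of level `k` chosen by `ω` but not by `ω'`. The target measure lives on
  -- the set `S` of points chosen by `ω'`, so all mass starting in `F` must travel at least `r k`.
  set F : Set X := (fun j => p ⟨k, j, ω k j⟩) '' J with hF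
  have hFm : MeasurableSet F := (J.finite_toSet.image _).measurableSet
  set S : Set X := ⋃ i, range fun j => p ⟨i, j, ω' i j⟩ with hS
  have hSm : MeasurableSet S :=
    MeasurableSet.iUnion fun i => (finite_range _).measurableSet
  have hS_ae : ∀ᵐ z ∂ρ, z.2 ∈ S := by
    refine ae_of_ae_map (p := fun x => x ∈ S) measurable_snd.aemeasurable ?_
    rw [hρ.2, choiceMeasure]
    refine (Measure.ae_sum_iff' (p := fun x => x ∈ S) hSm).2 ?_
    refine fun i => Measure.ae_smul_measure ?_ _
    rw [ae_iff, Measure.finsetSum_apply]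
    refine Finset.sum_eq_zero fun j _ => ?_
    change Measure.dirac _ Sᶜ = 0
    rw [Measure.dirac_apply' _ hSm.compl]
    have hmem : p ⟨i, j, ω' i j⟩ ∈ S := mem_iUnion.2 ⟨i, j, rfl⟩
    exact indicator_of_notMem (not_not.2 hmem) _
  have hmass : hammingDist (ω k) (ω' k) * ((2⁻¹ : ℝ≥0∞) ^ (k + 1) / Fintype.card (T k)) ≤
      ρ (Prod.fst ⁻¹' F) := by
    rw [← Measure.map_apply measurable_fst hFm, hρ.1, choiceMeasure]
    refine le_trans ?_ (Measure.le_sum_apply _ _)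
    refine le_trans ?_ (ENNReal.le_tsum k)
    rw [Measure.smul_apply, smul_eq_mul, mul_comm, Measure.finsetSum_apply]
    refine mul_le_mul_right ?_ _
    calc (hammingDist (ω k) (ω' k) : ℝ≥0∞) = ∑ j ∈ J, 1 := by simp [hJ, hammingDist]
      _ ≤ ∑ j ∈ J, Measure.dirac (p ⟨k, j, ω k j⟩) F := by
        refine Finset.sum_le_sum fun j hj => ?_
        rw [Measure.dirac_apply_of_mem]
        exact mem_image_of_mem (fun j => p ⟨k, j, ω k j⟩) hj
      _ ≤ ∑ j, Measure.dirac (p ⟨k, j, ω k j⟩) F :=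
        Finset.sum_le_sum_of_subset (Finset.subset_univ _)
  calc hammingDist (ω k) (ω' k) * ((2⁻¹ : ℝ≥0∞) ^ (k + 1) / Fintype.card (T k)) * r k ^ 2
      ≤ ρ (Prod.fst ⁻¹' F) * r k ^ 2 := by gcongr
    _ = ∫⁻ z in Prod.fst ⁻¹' F, r k ^ 2 ∂ρ := by rw [setLIntegral_const, mul_comm]
    _ ≤ ∫⁻ z in Prod.fst ⁻¹' F, edist z.1 z.2 ^ 2 ∂ρ := by
      refine lintegral_mono_ae ?_
      filter_upwards [ae_restrict_of_ae hS_ae, ae_restrict_mem (measurable_fst hFm)]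
      rintro ⟨x, y⟩ hyS ⟨j, hj, hx⟩
      obtain ⟨i, j', hy⟩ := mem_iUnion.1 hyS
      change p _ = x at hx
      change p _ = y at hy
      rw [← hx, ← hy]
      gcongr
      refine hp ⟨k, j, ω k j⟩ _ fun h => ?_
      obtain ⟨rfl, h⟩ := Sigma.mk.inj_iff.1 h
      obtain ⟨rfl, h⟩ := Prod.mk.inj (eq_of_heq h)
      exact (Finset.mem_filter.1 hj).2 h
    _ ≤ quadraticCost ρ := setLIntegral_le_lintegral _ _

variable [CompactSpace X] [BorelSpace X] [∀ k, Nonempty (T k)]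

/-- The choice measure as a point of the Wasserstein space. -/
noncomputable def choicePoint (p : (Σ k, T k × Bool) → X) (ω : ∀ k, T k → Bool) :
    WassersteinSpace X :=
  ⟨choiceMeasure p ω, isProbabilityMeasure_choiceMeasure p ω,
    p ⟨0, Classical.arbitrary _, true⟩, by
      have := isProbabilityMeasure_choiceMeasure p ω
      refine lt_of_le_of_lt (lintegral_mono (g := fun _ => Metric.ediam (univ : Set X) ^ 2)
        fun x => ?_) ?_
      · exact pow_le_pow_left₀ zero_le
          (Metric.edist_le_ediam_of_mem (mem_univ _) (mem_univ _)) 2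
      · rw [lintegral_const, measure_univ, mul_one]
        exact ENNReal.pow_lt_top
          (isCompact_univ (X := X)).isBounded.ediam_ne_top.lt_top⟩

lemma hammingDist_mul_le_edist_choicePoint
    (hp : ∀ a b, a ≠ b → r a.1 ≤ edist (p a) (p b)) (ω ω' : ∀ k, T k → Bool) (k : ℕ) :
    hammingDist (ω k) (ω' k) * ((2⁻¹ : ℝ≥0∞) ^ (k + 1) / Fintype.card (T k)) * r k ^ 2 ≤
      edist (choicePoint p ω) (choicePoint p ω') ^ 2 := by
  have hsq : ∀ x : ℝ≥0∞, (x ^ (1 / 2 : ℝ)) ^ 2 = x := fun x => by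
    rw [← ENNReal.rpow_natCast, ← ENNReal.rpow_mul]
    norm_num
  rw [WassersteinSpace.edist_def, wassersteinEDist, hsq]
  exact le_iInf₂ fun ρ hρ => hammingDist_mul_le_quadraticCost hp hρ k

/-- The law of independent uniform choices. -/
noncomputable def choiceLaw (T : ℕ → Type*) [∀ k, Fintype (T k)] [∀ k, DecidableEq (T k)] :
    Measure (∀ k, T k → Bool) :=
  Measure.infinitePi fun k => (PMF.uniformOfFintype (T k → Bool)).toMeasure

/-- Below this diameter, any two outcomes landing in `A` disagree on at most an eighth of the coins
of level `k`. Fixing one of them confines the others to a Hamming ball, whose probability depends on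
level `k` alone. -/
lemma choiceLaw_preimage_le [∀ k, DecidableEq (T k)]
    (hp : ∀ a b, a ≠ b → r a.1 ≤ edist (p a) (p b)) {k : ℕ}
    {A : Set (WassersteinSpace X)}
    (hA : Metric.ediam A ^ 2 < 2⁻¹ ^ (k + 1) / 8 * r k ^ 2) :
    choiceLaw T (choicePoint p ⁻¹' A) ≤ ENNReal.ofReal ((5 / 6) ^ Fintype.card (T k)) := by
  rcases (choicePoint p ⁻¹' A).eq_empty_or_nonempty with h | ⟨ω₀, hω₀⟩
  · simp [h]
  have hsub : choicePoint p ⁻¹' A ⊆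
      Function.eval k ⁻¹' {η | 8 * hammingDist η (ω₀ k) ≤ Fintype.card (T k)} := by
    intro ω hω
    rw [mem_preimage, mem_ofPred_eq]
    by_contra! hcard
    refine absurd hA (not_lt.2 ?_)
    calc (2⁻¹ : ℝ≥0∞) ^ (k + 1) / 8 * r k ^ 2
        ≤ hammingDist (ω k) (ω₀ k) * ((2⁻¹ : ℝ≥0∞) ^ (k + 1) / Fintype.card (T k)) * r k ^ 2 := by
          gcongr
          refine ENNReal.div_le_of_le_mul ?_
          have hle : (Fintype.card (T k) : ℝ≥0∞) ≤ 8 * hammingDist (ω k) (ω₀ k) := by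
            have := hcard.le
            exact_mod_cast this
          calc (2⁻¹ : ℝ≥0∞) ^ (k + 1)
              = Fintype.card (T k) * ((2⁻¹ : ℝ≥0∞) ^ (k + 1) / Fintype.card (T k)) :=
                (ENNReal.mul_div_cancel (by simp) (by simp)).symm
            _ ≤ 8 * hammingDist (ω k) (ω₀ k) *
                ((2⁻¹ : ℝ≥0∞) ^ (k + 1) / Fintype.card (T k)) := by gcongr
            _ = _ := by ring
      _ ≤ edist (choicePoint p ω) (choicePoint p ω₀) ^ 2 :=
          hammingDist_mul_le_edist_choicePoint hp ω ω₀ k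
      _ ≤ Metric.ediam A ^ 2 := by
          gcongr
          exact Metric.edist_le_ediam_of_mem hω hω₀
  refine (measure_mono hsub).trans ?_
  rw [choiceLaw, (measurePreserving_eval_infinitePi
    (fun k => (PMF.uniformOfFintype (T k → Bool)).toMeasure) k).measure_preimage
    (Set.toFinite _).measurableSet.nullMeasurableSet]
  exact uniformOfFintype_hammingDist_le (ω₀ k)

end RandomMeasure

/-! ### The mass distribution principle. -/

section MassDistribution

/-- The mass distribution principle. -/
lemma caratheodoryMeasure_eq_top_of_measure_preimage_le {Y Ω : Type*} [MetricSpace Y]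
    [MeasurableSpace Ω] (P : Measure Ω) [IsProbabilityMeasure P] (Φ : Ω → Y) {f : ℝ → ℝ}
    (h : ∀ η : ℝ, 0 < η → ∃ δ : ℝ, 0 < δ ∧ ∀ A : Set Y, Metric.ediam A ≤ ENNReal.ofReal δ →
      P (Φ ⁻¹' A) ≤ ENNReal.ofReal η * ENNReal.ofReal (f (Metric.diam A))) :
    caratheodoryMeasure f (univ : Set Y) = ∞ := by
  refine ENNReal.eq_top_of_forall_nnreal_le fun c => ?_
  have hc : (0 : ℝ) < c + 1 := by positivity
  obtain ⟨δ, hδ, hA⟩ := h (c + 1)⁻¹ (by positivity)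
  refine le_iSup₂_of_le δ hδ (le_iInf fun E => le_iInf fun hE => le_iInf fun hEd => ?_)
  have h1 : (1 : ℝ≥0∞) ≤ ENNReal.ofReal (c + 1)⁻¹ *
      ∑' i, ENNReal.ofReal (f (Metric.diam (E i))) := by
    calc (1 : ℝ≥0∞) = P (⋃ i, Φ ⁻¹' (E i)) := by
          rw [← preimage_iUnion, univ_subset_iff.1 hE, preimage_univ, measure_univ]
      -- Countable subadditivity holds for the outer measure, so measurability of `Φ` plays no role.
      _ ≤ ∑' i, P (Φ ⁻¹' (E i)) := measure_iUnion_le _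
      _ ≤ ∑' i, ENNReal.ofReal (c + 1)⁻¹ * ENNReal.ofReal (f (Metric.diam (E i))) :=
          ENNReal.tsum_le_tsum fun i => hA _ (hEd i).2
      _ = _ := ENNReal.tsum_mul_left
  calc (c : ℝ≥0∞) = ENNReal.ofReal c := by simp
    _ ≤ ENNReal.ofReal (c + 1) * 1 := by
      rw [mul_one]; exact ENNReal.ofReal_le_ofReal (by linarith)
    _ ≤ ENNReal.ofReal (c + 1) * (ENNReal.ofReal (c + 1)⁻¹ *
      ∑' i, ENNReal.ofReal (f (Metric.diam (E i)))) := by gcongr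
    _ = _ := by
      rw [← mul_assoc, ← ENNReal.ofReal_mul hc.le, mul_inv_cancel₀ hc.ne', ENNReal.ofReal_one,
        one_mul]

lemma tendsto_mul_pow_sub_mul_pow_atTop {κ K γ G : ℝ} (hκ : 0 < κ) (hγ : 0 ≤ γ) (hG : 1 < G)
    (h : γ < G) : Tendsto (fun k : ℕ => κ * G ^ k - K * γ ^ k) atTop atTop := by
  have hG0 : 0 < G := one_pos.trans hG
  have h₁ : Tendsto (fun k : ℕ => κ - K * (γ / G) ^ k) atTop (𝓝 κ) := by
    have := (tendsto_pow_atTop_nhds_zero_of_lt_one (div_nonneg hγ hG0.le)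
      ((div_lt_one hG0).2 h)).const_mul K
    simpa using tendsto_const_nhds.sub this
  refine ((tendsto_pow_atTop_atTop_of_one_lt hG).atTop_mul_pos hκ h₁).congr fun k => ?_
  rw [div_pow]
  field_simp

/-- If sets of diameter less than `R₀ * β ^ k` have mass at most `(5 / 6) ^ G ^ k`, then
Carathéodory's construction is infinite for the exponents `s` such that `β ^ (-s) < G`. -/
lemma caratheodoryMeasure_powerExpScale_eq_top {Y Ω : Type*} [MetricSpace Y]
    [MeasurableSpace Ω] (P : Measure Ω) [IsProbabilityMeasure P] (Φ : Ω → Y) {R₀ β s : ℝ} {G : ℕ}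
    (hR₀ : 0 < R₀) (hβ0 : 0 < β) (hβ1 : β < 1) (hs : 0 < s) (hG : 1 < G) (hsG : β ^ (-s) < G)
    (h : ∀ (k : ℕ) (A : Set Y), Metric.ediam A < ENNReal.ofReal (R₀ * β ^ k) →
      P (Φ ⁻¹' A) ≤ ENNReal.ofReal ((5 / 6) ^ G ^ k)) :
    caratheodoryMeasure (powerExpScale s) (univ : Set Y) = ∞ := by
  refine caratheodoryMeasure_eq_top_of_measure_preimage_le P Φ fun η hη => ?_
  have hκ : 0 < Real.log (6 / 5) := Real.log_pos (by norm_num)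
  have hlim := (tendsto_mul_pow_sub_mul_pow_atTop (K := (R₀ * β) ^ (-s)) hκ
    (Real.rpow_nonneg hβ0.le (-s)) (by exact_mod_cast hG) hsG).eventually_ge_atTop (-Real.log η)
  obtain ⟨k₀, hk₀⟩ := eventually_atTop.1 hlim
  have hRpos : ∀ k, 0 < R₀ * β ^ k := fun k => by positivity
  have hRanti : ∀ {i j : ℕ}, i ≤ j → R₀ * β ^ j ≤ R₀ * β ^ i := fun hij => by
    have := pow_le_pow_of_le_one hβ0.le hβ1.le hij
    gcongr
  have hRlim : Tendsto (fun k => R₀ * β ^ k) atTop (𝓝 0) := by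
    simpa using (tendsto_pow_atTop_nhds_zero_of_lt_one hβ0.le hβ1).const_mul R₀
  refine ⟨R₀ * β ^ (k₀ + 1), hRpos _, fun A hA => ?_⟩
  have hAfin : Metric.ediam A ≠ ∞ := (hA.trans_lt ENNReal.ofReal_lt_top).ne
  have hAof : Metric.ediam A = ENNReal.ofReal (Metric.diam A) := (ENNReal.ofReal_toReal hAfin).symm
  have hAle : Metric.diam A ≤ R₀ * β ^ (k₀ + 1) :=
    ENNReal.toReal_le_of_le_ofReal (hRpos _).le hA
  -- The scale vanishes at `0`, so a set of diameter zero must have mass exactly zero; the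
  -- hypothesis at all levels gives this.
  rcases (Metric.diam_nonneg (s := A)).eq_or_lt with h0 | h0
  · have hle : ∀ k, P (Φ ⁻¹' A) ≤ ENNReal.ofReal ((5 / 6) ^ G ^ k) := fun k => by
      refine h k A ?_
      rw [hAof, ← h0]
      simpa using hRpos k
    have ht : Tendsto (fun k : ℕ => ENNReal.ofReal ((5 / 6) ^ G ^ k)) atTop (𝓝 0) := by
      have h₁ := (tendsto_pow_atTop_nhds_zero_of_lt_one (r := (5 / 6 : ℝ)) (by norm_num)
        (by norm_num)).comp (tendsto_pow_atTop_atTop_of_one_lt hG)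
      simpa using ENNReal.tendsto_ofReal h₁
    exact (ge_of_tendsto' ht hle).trans zero_le
  -- Select `k` with `R₀ * β ^ (k + 1) ≤ diam A < R₀ * β ^ k`. The choice of `δ` forces `k₀ ≤ k`.
  have hex : ∃ k, R₀ * β ^ k ≤ Metric.diam A :=
    (hRlim.eventually (eventually_le_nhds h0)).exists
  classical
  obtain ⟨k, hk⟩ : ∃ k, Nat.find hex = k + 1 := by
    refine Nat.exists_eq_succ_of_ne_zero fun hzero => ?_
    have h₁ := Nat.find_spec hex
    rw [hzero] at h₁
    have h₂ : R₀ * β ^ (k₀ + 1) < R₀ * β ^ 0 := by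
      have := pow_lt_pow_right_of_lt_one₀ hβ0 hβ1 (Nat.succ_pos k₀)
      gcongr
    linarith
  have hk1 : R₀ * β ^ (k + 1) ≤ Metric.diam A := hk ▸ Nat.find_spec hex
  have hk2 : Metric.diam A < R₀ * β ^ k := not_le.1 (Nat.find_min hex (by omega))
  have hkk₀ : k₀ ≤ k := by
    by_contra! hlt
    have h₁ : R₀ * β ^ (k₀ + 1) < R₀ * β ^ k₀ := by
      have := pow_lt_pow_right_of_lt_one₀ hβ0 hβ1 (Nat.lt_succ_self k₀)
      gcongr
    linarith [hRanti (show k + 1 ≤ k₀ from hlt)]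
  refine (h k A (by rw [hAof]; exact (ENNReal.ofReal_lt_ofReal_iff (hRpos k)).2 hk2)).trans ?_
  rw [← ENNReal.ofReal_mul hη.le, powerExpScale_of_ne_zero s h0.ne']
  refine ENNReal.ofReal_le_ofReal ?_
  have hpow : (1 / Metric.diam A) ^ s ≤ (R₀ * β) ^ (-s) * (β ^ (-s)) ^ k := by
    calc (1 / Metric.diam A) ^ s ≤ (1 / (R₀ * β ^ (k + 1))) ^ s := by gcongr
      _ = (R₀ * β ^ (k + 1)) ^ (-s) := by
        rw [one_div, Real.inv_rpow (hRpos _).le, Real.rpow_neg (hRpos _).le]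
      _ = (R₀ * β) ^ (-s) * (β ^ (-s)) ^ k := by
        rw [← Real.rpow_natCast (β ^ (-s)), ← Real.rpow_mul hβ0.le, mul_comm (-s),
          Real.rpow_mul hβ0.le, Real.rpow_natCast, ← Real.mul_rpow (by positivity) (by positivity)]
        congr 1
        ring
  calc (5 / 6 : ℝ) ^ G ^ k = Real.exp (-(Real.log (6 / 5) * G ^ k)) := by
        rw [Real.exp_neg, ← Nat.cast_pow, mul_comm, Real.exp_nat_mul, Real.exp_log (by norm_num),
          ← inv_pow]
        norm_num
    _ ≤ Real.exp (Real.log η + -(1 / Metric.diam A) ^ s) := by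
        gcongr
        linarith [hk₀ k hkk₀]
    _ = η * Real.exp (-(1 / Metric.diam A) ^ s) := by rw [Real.exp_add, Real.exp_log hη]

end MassDistribution

/-! ### A separated multi-level configuration in the cube. -/

section CubeConfiguration

/-- The index set of the pairs of points of level `k` in the cube of dimension `n + 1`. -/
abbrev CubeIndex (m n k : ℕ) : Type := Fin (2 ^ (m * k)) × (Fin n → Fin (2 ^ ((m + 1) * k)))

lemma card_cubeIndex (m n k : ℕ) :
    Fintype.card (CubeIndex m n k) = (2 ^ (m + n * (m + 1))) ^ k := by
  rw [Fintype.card_prod, Fintype.card_fun, Fintype.card_fin, Fintype.card_fin, Fintype.card_fin,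
    ← pow_mul, ← pow_mul, ← pow_add]
  congr 1
  ring

instance (m n k : ℕ) : Nonempty (CubeIndex m n k) := by
  rw [← Fintype.card_pos_iff, card_cubeIndex]
  positivity

/-- The first coordinate of a point of level `k`. It lies in `[2 ^ (-k) / 2, 3 * 2 ^ (-k) / 4]`. -/
noncomputable def cubeFirstCoord (m : ℕ) {k : ℕ} (a : Fin (2 ^ (m * k))) (b : Bool) : ℝ :=
  (1 / 2) ^ k * (1 / 2 + ((2 * a + b.toNat : ℕ) : ℝ) / (8 * 2 ^ (m * k)))

lemma le_cubeFirstCoord {m k : ℕ} (a : Fin (2 ^ (m * k))) (b : Bool) :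
    (1 / 2) ^ k / 2 ≤ cubeFirstCoord m a b := by
  rw [cubeFirstCoord, mul_add, mul_one_div]
  exact le_add_of_nonneg_right (by positivity)

lemma cubeFirstCoord_le {m k : ℕ} (a : Fin (2 ^ (m * k))) (b : Bool) :
    cubeFirstCoord m a b ≤ 3 / 4 * (1 / 2) ^ k := by
  have h : 2 * (a : ℕ) + b.toNat ≤ 2 * 2 ^ (m * k) := by
    have := a.2
    have := Bool.toNat_le b
    omega
  have h' : ((2 * a + b.toNat : ℕ) : ℝ) ≤ 2 * 2 ^ (m * k) := by exact_mod_cast h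
  have h'' : ((2 * a + b.toNat : ℕ) : ℝ) / (8 * 2 ^ (m * k)) ≤ 1 / 4 := by
    rw [div_le_iff₀ (by positivity)]
    linarith
  rw [cubeFirstCoord, mul_comm]
  gcongr
  linarith

/-- The integers `2 * a + b` are distinct for distinct pairs, and one unit corresponds to `2 ^ (-(m
+ 1) * k) / 8`. -/
lemma le_abs_cubeFirstCoord_sub {m k : ℕ} {a a' : Fin (2 ^ (m * k))} {b b' : Bool}
    (h : (a, b) ≠ (a', b')) :
    1 / 8 * (1 / 2) ^ ((m + 1) * k) ≤ |cubeFirstCoord m a b - cubeFirstCoord m a' b'| := by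
  have hne : ((2 * a + b.toNat : ℕ) : ℤ) ≠ (2 * a' + b'.toNat : ℕ) := by
    intro heq
    have heq : 2 * (a : ℕ) + b.toNat = 2 * (a' : ℕ) + b'.toNat := by exact_mod_cast heq
    have hb := Bool.toNat_le b
    have hb' := Bool.toNat_le b'
    have ha : a = a' := Fin.ext (by omega)
    have hbb : b.toNat = b'.toNat := by omega
    have hinj : ∀ b b' : Bool, b.toNat = b'.toNat → b = b' := by decide
    exact h (Prod.ext ha (hinj _ _ hbb))
  have hone : (1 : ℝ) ≤ |((2 * a + b.toNat : ℕ) : ℝ) - ((2 * a' + b'.toNat : ℕ) : ℝ)| := by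
    have := Int.one_le_abs (sub_ne_zero.2 hne)
    exact_mod_cast this
  have e : cubeFirstCoord m a b - cubeFirstCoord m a' b' = 1 / 8 * (1 / 2) ^ ((m + 1) * k) *
      (((2 * a + b.toNat : ℕ) : ℝ) - ((2 * a' + b'.toNat : ℕ) : ℝ)) := by
    rw [cubeFirstCoord, cubeFirstCoord, add_mul, one_mul, pow_add, one_div_pow _ (m * k)]
    field_simp
    ring
  have hpos : (0 : ℝ) < 1 / 8 * (1 / 2) ^ ((m + 1) * k) := by positivity
  rw [e, abs_mul, abs_of_pos hpos]
  exact le_mul_of_one_le_right hpos.le hone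

/-- Different levels occupy disjoint slabs; the gap is at least `2 ^ (-k) / 2 - 3 / 4 * 2 ^ (-(k +
1)) = 2 ^ (-k) / 8`. -/
lemma le_abs_cubeFirstCoord_sub_of_lt {m k k' : ℕ} (hk : k < k') (a : Fin (2 ^ (m * k)))
    (a' : Fin (2 ^ (m * k'))) (b b' : Bool) :
    1 / 8 * (1 / 2) ^ k ≤ |cubeFirstCoord m a b - cubeFirstCoord m a' b'| := by
  have h : (1 / 2 : ℝ) ^ k' ≤ (1 / 2) ^ (k + 1) :=
    pow_le_pow_of_le_one (by norm_num) (by norm_num) hk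
  rw [pow_succ] at h
  refine le_trans ?_ (le_abs_self _)
  linarith [le_cubeFirstCoord a b, cubeFirstCoord_le a' b']

/-- The points of the configuration in the cube. -/
noncomputable def cubePoint (m n : ℕ) (x : Σ k, CubeIndex m n k × Bool) :
    EuclideanSpace ℝ (Fin (n + 1)) :=
  WithLp.toLp 2 (Fin.cons (cubeFirstCoord m x.2.1.1 x.2.2)
    fun i => (x.2.1.2 i : ℝ) / 2 ^ ((m + 1) * x.1))

lemma cubePoint_mem (m n : ℕ) (x : Σ k, CubeIndex m n k × Bool) :
    cubePoint m n x ∈ euclideanCube (n + 1) := by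
  obtain ⟨k, ⟨a, j⟩, b⟩ := x
  intro i
  refine Fin.cases ?_ (fun i => ?_) i
  · have h1 : (1 / 2 : ℝ) ^ k ≤ 1 := pow_le_one₀ (by norm_num) (by norm_num)
    have h0 : (0 : ℝ) ≤ (1 / 2) ^ k := by positivity
    constructor
    · change 0 ≤ cubeFirstCoord m a b
      linarith [le_cubeFirstCoord a b]
    · change cubeFirstCoord m a b ≤ 1
      linarith [cubeFirstCoord_le a b]
  · change (j i : ℝ) / 2 ^ ((m + 1) * k) ∈ Icc 0 1
    refine ⟨by positivity, (div_le_one (by positivity)).2 ?_⟩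
    exact_mod_cast (j i).2.le

/-- One coordinate always suffices: the first one between levels or between different `(a, b)`, a
grid coordinate otherwise. The bound involves the level of `x` only, as mass leaving level `k` may
go to any level. -/
lemma le_dist_cubePoint {m n : ℕ} {x y : Σ k, CubeIndex m n k × Bool} (h : x ≠ y) :
    1 / 8 * (1 / 2) ^ ((m + 1) * x.1) ≤ dist (cubePoint m n x) (cubePoint m n y) := by
  obtain ⟨k, ⟨a, j⟩, b⟩ := x
  obtain ⟨k', ⟨a', j'⟩, b'⟩ := y
  have h0 : |cubeFirstCoord m a b - cubeFirstCoord m a' b'| ≤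
      dist (cubePoint m n ⟨k, (a, j), b⟩) (cubePoint m n ⟨k', (a', j'), b'⟩) := by
    rw [← Real.dist_eq]
    exact PiLp.dist_apply_le (cubePoint m n ⟨k, (a, j), b⟩) (cubePoint m n ⟨k', (a', j'), b'⟩) 0
  have hpow : ∀ i : ℕ, (1 / 2 : ℝ) ^ ((m + 1) * i) ≤ (1 / 2) ^ i := fun i =>
    pow_le_pow_of_le_one (by norm_num) (by norm_num) (Nat.le_mul_of_pos_left _ m.succ_pos)
  dsimp only
  rcases lt_trichotomy k k' with hk | rfl | hk
  · linarith [le_abs_cubeFirstCoord_sub_of_lt hk a a' b b', hpow k]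
  · by_cases hab : (a, b) = (a', b')
    · obtain ⟨rfl, rfl⟩ := Prod.mk.inj hab
      have hj : j ≠ j' := by rintro rfl; exact h rfl
      obtain ⟨i, hi⟩ := Function.ne_iff.1 hj
      have hne : ((j i : ℕ) : ℤ) ≠ (j' i : ℕ) := fun heq =>
        hi (Fin.ext (by exact_mod_cast heq))
      have hone : (1 : ℝ) ≤ |((j i : ℕ) : ℝ) - (j' i : ℕ)| := by
        have := Int.one_le_abs (sub_ne_zero.2 hne)
        exact_mod_cast this
      have hi : |((j i : ℕ) : ℝ) / 2 ^ ((m + 1) * k) - ((j' i : ℕ) : ℝ) / 2 ^ ((m + 1) * k)| ≤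
          dist (cubePoint m n ⟨k, (a, j), b⟩) (cubePoint m n ⟨k, (a, j'), b⟩) := by
        rw [← Real.dist_eq]
        exact PiLp.dist_apply_le (cubePoint m n ⟨k, (a, j), b⟩) (cubePoint m n ⟨k, (a, j'), b⟩)
          i.succ
      refine le_trans ?_ hi
      have hpos : (0 : ℝ) < 2 ^ ((m + 1) * k) := by positivity
      rw [← sub_div, abs_div, abs_of_pos hpos, one_div_pow, le_div_iff₀ hpos]
      field_simp
      linarith
    · exact (le_abs_cubeFirstCoord_sub hab).trans h0
  · rw [abs_sub_comm] at h0
    have hk' : (1 / 2 : ℝ) ^ k ≤ (1 / 2) ^ k' :=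
      pow_le_pow_of_le_one (by norm_num) (by norm_num) hk.le
    linarith [le_abs_cubeFirstCoord_sub_of_lt hk a' a b' b, hpow k]

end CubeConfiguration

/-! ### Lower bound for the critical parameter. -/

section LowerBound

variable {X : Type*} [MetricSpace X] [CompactSpace X] [MeasurableSpace X] [BorelSpace X]

lemma AdmitsBiLipschitzCube.caratheodoryMeasure_eq_top {n : ℕ}
    (h : AdmitsBiLipschitzCube X (n + 1)) {s : ℝ} (hs : 0 < s) (hsn : s < n + 1) :
    caratheodoryMeasure (powerExpScale s) (univ : Set (WassersteinSpace X)) = ∞ := by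
  obtain ⟨g, -, L, -, hg⟩ := h
  -- This is `s * (m + 3 / 2) < m + n * (m + 1)` solved for `m`, possible because the ratio of the
  -- two exponents tends to `n + 1 > s`. The extra `+ 1` ensures `1 < m`.
  obtain ⟨m, hm⟩ := exists_nat_gt ((1 + s / 2) / (n + 1 - s) + 1)
  have hsub : 0 < (n : ℝ) + 1 - s := by linarith
  have hdiv : 0 < (1 + s / 2) / (n + 1 - s) := by positivity
  have hm1 : (1 : ℝ) < m := by linarith
  have hm2 : s * (m + 3 / 2) < m + n * (m + 1) := by
    have : (1 + s / 2) / (n + 1 - s) < m + 1 := by linarith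
    rw [div_lt_iff₀ hsub] at this
    linarith
  set ℓ : ℝ := L + 1 with hℓ
  have hℓ0 : 0 < ℓ := by positivity
  set p : (Σ k, CubeIndex m n k × Bool) → X := fun x => g ⟨cubePoint m n x, cubePoint_mem m n x⟩
  set r : ℕ → ℝ≥0∞ := fun k => ENNReal.ofReal (1 / 8 * (1 / 2) ^ ((m + 1) * k) / ℓ) with hr
  have hp : ∀ x y, x ≠ y → r x.1 ≤ edist (p x) (p y) := by
    intro x y hxy
    rw [edist_dist]
    refine ENNReal.ofReal_le_ofReal ((div_le_iff₀ hℓ0).2 ?_)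
    calc 1 / 8 * (1 / 2) ^ ((m + 1) * x.1) ≤ dist (cubePoint m n x) (cubePoint m n y) :=
          le_dist_cubePoint hxy
      _ ≤ L * dist (p x) (p y) := hg.le_mul_dist ⟨_, cubePoint_mem m n x⟩ ⟨_, cubePoint_mem m n y⟩
      _ ≤ dist (p x) (p y) * ℓ := by rw [mul_comm]; gcongr; simp [hℓ]
  -- The exponent is `m + 1` from the separation plus `1 / 2` from the square root of the mass `2 ^
  -- (-k)`. The value `R₀ = 1 / (32 * ℓ)` below makes `(R₀ * β ^ k) ^ 2` equal to the threshold `2 ^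
  -- (-(k + 1)) / 8 * r k ^ 2`.
  set β : ℝ := 2 ^ (-(m + 3 / 2 : ℝ)) with hβ
  have hβ0 : 0 < β := by positivity
  have hβsq : β ^ 2 = (1 / 2) ^ (2 * (m + 1) + 1) := by
    rw [hβ, ← Real.rpow_natCast, ← Real.rpow_mul (by norm_num), one_div, inv_pow,
      ← Real.rpow_natCast, ← Real.rpow_neg (by norm_num)]
    congr 1
    push_cast
    ring
  have : IsProbabilityMeasure (choiceLaw (CubeIndex m n)) := by
    unfold choiceLaw; infer_instance
  refine caratheodoryMeasure_powerExpScale_eq_top (choiceLaw (CubeIndex m n)) (choicePoint p)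
    (R₀ := 1 / (32 * ℓ)) (β := β) (G := 2 ^ (m + n * (m + 1))) (by positivity) hβ0 ?_ hs ?_ ?_ ?_
  · exact Real.rpow_lt_one_of_one_lt_of_neg (by norm_num) (by linarith)
  · refine Nat.one_lt_two_pow ?_
    have : 1 < m := by exact_mod_cast hm1
    omega
  · rw [hβ, ← Real.rpow_mul (by norm_num)]
    push_cast
    rw [← Real.rpow_natCast]
    refine Real.rpow_lt_rpow_of_exponent_lt (by norm_num) ?_
    push_cast
    linarith
  · intro k A hA
    rw [← card_cubeIndex]
    refine choiceLaw_preimage_le hp ?_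
    calc Metric.ediam A ^ 2 < ENNReal.ofReal (1 / (32 * ℓ) * β ^ k) ^ 2 :=
          ENNReal.pow_lt_pow_left two_ne_zero hA
      _ = ENNReal.ofReal ((1 / 2) ^ (k + 1) / 8 * (1 / 8 * (1 / 2) ^ ((m + 1) * k) / ℓ) ^ 2) := by
          rw [← ENNReal.ofReal_pow (by positivity), mul_pow, ← pow_mul, mul_comm k 2, pow_mul, hβsq]
          have hpow : ((1 / 2 : ℝ) ^ (2 * (m + 1) + 1)) ^ k =
              (1 / 2) ^ k * ((1 / 2) ^ ((m + 1) * k)) ^ 2 := by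
            rw [← pow_mul, ← pow_mul, ← pow_add]
            congr 1
            ring
          rw [hpow, pow_succ]
          congr 1
          ring_nf
      _ = 2⁻¹ ^ (k + 1) / 8 * r k ^ 2 := by
          rw [ENNReal.ofReal_mul (by positivity), ENNReal.ofReal_pow (by positivity),
            ENNReal.ofReal_div_of_pos (by norm_num), ENNReal.ofReal_pow (by norm_num), one_div,
            ENNReal.ofReal_inv_of_pos (by norm_num)]
          simp [hr]

lemma AdmitsBiLipschitzCube.le_critParam {d : ℕ} (h : AdmitsBiLipschitzCube X d) :
    (d : ℝ≥0∞) ≤ critParam powerExpScale (univ : Set (WassersteinSpace X)) := by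
  rcases d with - | n
  · simp
  refine le_of_forall_lt fun c hc => ?_
  obtain ⟨s, hcs, hsn⟩ := exists_between hc
  have hs_top : s ≠ ∞ := (hsn.trans_le le_top).ne
  have hs0 : 0 < s.toReal := ENNReal.toReal_pos (zero_le.trans_lt hcs).ne' hs_top
  have hsn' : s.toReal < n + 1 := by
    have := (ENNReal.toReal_lt_toReal hs_top (ENNReal.natCast_ne_top _)).2 hsn
    rw [ENNReal.toReal_natCast] at this
    exact_mod_cast this
  refine hcs.trans_le ?_
  rw [← ENNReal.ofReal_toReal hs_top]
  exact le_iSup₂_of_le s.toReal hs0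
    (le_iSup_of_le (h.caratheodoryMeasure_eq_top hs0 hsn') le_rfl)

end LowerBound

theorem mainTheorem1 :
    (∀ (X : Type u) [MetricSpace X] [CompactSpace X] [MeasurableSpace X] [BorelSpace X] (d : ℕ),
      upperMinkowskiDim X = d → AdmitsBiLipschitzCube X d →
        critParam powerExpScale (univ : Set (WassersteinSpace X)) = d) ∧
    (∀ (E : Type v) [NormedAddCommGroup E] [NormedSpace ℝ E] [FiniteDimensional ℝ E]
      (H : Type w) [TopologicalSpace H] (I : ModelWithCorners ℝ E H)
      (X : Type u) [MetricSpace X] [CompactSpace X] [Nonempty X] [MeasurableSpace X] [BorelSpace X]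
      [ChartedSpace H X] [IsManifold I 1 X]
      [Bundle.RiemannianBundle (fun x : X => TangentSpace I x)]
      [IsContinuousRiemannianBundle E (fun x : X => TangentSpace I x)],
      IsLocallyRiemannian I X →
        critParam powerExpScale (univ : Set (WassersteinSpace X)) = Module.finrank ℝ E) := by
  refine ⟨fun X _ _ _ _ d hdim hcube => ?_, fun E _ _ _ H _ I X _ _ _ _ _ _ _ _ _ hI => ?_⟩
  · refine le_antisymm (critParam_wassersteinSpace_le fun s hs => ?_) hcube.le_critParam
    refine .of_upperMinkowskiDim_lt ?_
    rw [hdim, ← ENNReal.ofReal_natCast]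
    exact (ENNReal.ofReal_lt_ofReal_iff ((Nat.cast_nonneg d).trans_lt hs)).2 hs
  · exact le_antisymm
      (critParam_wassersteinSpace_le fun s hs => hI.hasCoveringExponent.mono_exponent hs.le)
      hI.admitsBiLipschitzCube.le_critParam
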